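/- Let $0<b<a$ and consider the error equations (zero source, zero initial and zero outer boundary data) of the Dirichlet–Neumann waveform relaxation (DNWR) algorithm for the heat equation $\partial_t u=\partial_{xx}u$ on $(-a,b)$, with Dirichlet subdomain $(-a,0)$, Neumann subdomain $(0,b)$ and relaxation parameter $\theta=1/2$. Starting from an interface function $h^0(t)$, for $k=1,2,\dots$ one solves in turn $$\partial_t u_1^k=\partial_{xx}u_1^k \text{ on } (-a,0),\quad u_1^k(x,0)=0,\quad u_1^k(-a,t)=0,\quad u_1^k(0,t)=h^{k-1}(t),$$ $$\partial_t u_2^k=\partial_{xx}u_2^k \text{ on } (0,b),\quad u_2^k(x,0)=0,\quad \partial_x u_2^k(0,t)=\partial_x u_1^k(0,t),\quad u_2^k(b,t)=0,$$ and sets $h^k(t)=\tfrac12u_2^k(0,t)+\tfrac12h^{k-1}(t)$. After a Laplace transform $\hat f(s)=\int_0^\infty e^{-st}f(t)\,dt$ in time this becomes, for $\operatorname{Re}s>c$ with some $c\ge 0$, $$(s-\partial_{xx})\hat u_1^k=0 \text{ on } (-a,0),\quad \hat u_1^k(-a,s)=0,\quad \hat u_1^k(0,s)=\hat h^{k-1}(s),$$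 $$(s-\partial_{xx})\hat u_2^k=0 \text{ on } (0,b),\quad \partial_x\hat u_2^k(0,s)=\partial_x\hat u_1^k(0,s),\quad \hat u_2^k(b,s)=0,$$ $$\hat h^k(s)=\tfrac12\hat u_2^k(0,s)+\tfrac12\hat h^{k-1}(s).$$ For every $h^0$ whose Laplace transform converges absolutely for $\operatorname{Re}s>c$, the Laplace transformed iteration can be carried out: there are functions $h^k$ on $(0,\infty)$ with Laplace transforms converging absolutely for $\operatorname{Re}s>c$, and $\hat u_1^k,\hat u_2^k$, that satisfy it. Every sequence $(h^k)$ so obtained satisfies, for all $k\ge 0$, the linear estimate $$\|h^k\|_{L^\infty(0,\infty)}\le\Big(\frac{a-b}{2a}\Big)^k\|h^0\|_{L^\infty(0,\infty)},$$ and, for every $T>0$ and all $k\ge 0$, the superlinear estimate $$\|h^k\|_{L^\infty(0,T)}\le\Big(\frac{a-b}{a}\Big)^k\operatorname{erfc}\Big(\frac{kb}{2\sqrt T}\Big)\|h^0\|_{L^\infty(0,T)},\qquad \operatorname{erfc}(x)=\frac{2}{\sqrt\pi}\int_x^\infty e^{-z^2}\,dz.$$ The first estimate also holds whenever the iteration is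 satisfied in the time domain on $(0,\infty)$ by classical solutions $u_1^k,u_2^k$ of the heat equation, and the second whenever it is satisfied in this way on a finite window $(0,T)$. (Classical solutions are continuous up to the boundary, except possibly at the point $x=0$, $t=0$, near which they are bounded, and have one-sided $x$-derivatives at the interface.) A right-hand side with $\|h^0\|=\infty$ is read as $\infty$. -/

import Mathlib

open MeasureTheory Set
open scoped ENNReal

noncomputable section

namespace DNWR

/-- The complementary error function `erfc x = (2 / √π) ∫_x^∞ e^{-z²} dz`. -/
def erfc (x : ℝ) : ℝ := 2 / Real.sqrt Real.pi * ∫ z in Ioi x, Real.exp (-z ^ 2)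

/-- The norm of `L^∞(J)`, for a set of times `J`; it is `∞` when `f` is essentially unbounded. -/
def supNorm (J : Set ℝ) (f : ℝ → ℝ) : ℝ≥0∞ := eLpNorm f ∞ (volume.restrict J)

/-! ### The algorithm after a Laplace transform in time -/

/-- The Laplace transform `f̂(s) = ∫_0^∞ e^{-st} f(t) dt`. -/
def laplace (f : ℝ → ℝ) (s : ℂ) : ℂ := ∫ t in Ioi (0 : ℝ), Complex.exp (-s * t) * (f t : ℂ)

/-- The integral defining `f̂(s)` converges absolutely whenever `Re s > c`. -/
def HasLaplace (c : ℝ) (f : ℝ → ℝ) : Prop :=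
  ∀ σ : ℝ, c < σ → IntegrableOn (fun t => Real.exp (-σ * t) * f t) (Ioi 0)

/-- `(s - ∂ₓₓ) v = 0` on the interval `(l, r)`, with `v` of class `C²` up to the end points. -/
structure SolvesODE (s : ℂ) (l r : ℝ) (v : ℝ → ℂ) : Prop where
  contDiffOn : ContDiffOn ℝ 2 v (Icc l r)
  eq_zero : ∀ x ∈ Ioo l r, s * v x - iteratedDeriv 2 v x = 0

/-- The Laplace transformed DNWR iteration for the error equations of the heat equation on
`(-a, b)`, with Dirichlet subdomain `(-a, 0)`, Neumann subdomain `(0, b)` and relaxation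
parameter `θ`, on the half-plane `Re s > c`. Here `h k` is the `k`-th interface function of time,
and `U₁ k x s`, `U₂ k x s` (for `1 ≤ k`) are the transformed subdomain solutions. -/
structure IsLaplaceIteration (a b θ c : ℝ) (h : ℕ → ℝ → ℝ) (U₁ U₂ : ℕ → ℝ → ℂ → ℂ) : Prop where
  hasLaplace : ∀ k, HasLaplace c (h k)
  /-- The Dirichlet step. -/
  ode₁ : ∀ k, ∀ s : ℂ, c < s.re → SolvesODE s (-a) 0 (fun x => U₁ (k + 1) x s)
  outer₁ : ∀ k, ∀ s : ℂ, c < s.re → U₁ (k + 1) (-a) s = 0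
  dirichlet : ∀ k, ∀ s : ℂ, c < s.re → U₁ (k + 1) 0 s = laplace (h k) s
  /-- The Neumann step. -/
  ode₂ : ∀ k, ∀ s : ℂ, c < s.re → SolvesODE s 0 b (fun x => U₂ (k + 1) x s)
  outer₂ : ∀ k, ∀ s : ℂ, c < s.re → U₂ (k + 1) b s = 0
  neumann : ∀ k, ∀ s : ℂ, c < s.re →
    derivWithin (fun x => U₂ (k + 1) x s) (Icc 0 b) 0 =
      derivWithin (fun x => U₁ (k + 1) x s) (Icc (-a) 0) 0
  /-- The update of the interface function. -/
  update : ∀ k, ∀ s : ℂ, c < s.re →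
    laplace (h (k + 1)) s = θ * U₂ (k + 1) 0 s + (1 - θ) * laplace (h k) s

/-! ### The algorithm in the time domain -/

/-- `u` is a classical solution of `∂ₜu = ∂ₓₓu` for `x ∈ (l, r)` and times `t ∈ J`, where `J` is
`(0, T)` or `(0, ∞)`, with `u = 0` at `t = 0`. It is continuous up to the boundary, except
possibly at the point `x = 0`, `t = 0` where the interface meets the initial line (the interface
data need not vanish as `t → 0`), and there it remains bounded. -/
structure SolvesHeat (l r : ℝ) (J : Set ℝ) (u : ℝ → ℝ → ℝ) : Prop where
  continuousOn :
    ContinuousOn (fun p : ℝ × ℝ => u p.1 p.2) ((Icc l r ×ˢ insert 0 J) \ {((0 : ℝ), (0 : ℝ))})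
  locallyBounded : ∀ τ ∈ J, ∃ M : ℝ, ∀ x ∈ Icc l r, ∀ t ∈ J, t ≤ τ → |u x t| ≤ M
  initial : ∀ x ∈ Icc l r, x ≠ 0 → u x 0 = 0
  differentiableAt : ∀ x ∈ Ioo l r, ∀ t ∈ J, DifferentiableAt ℝ (fun t' => u x t') t
  contDiffAt : ∀ x ∈ Ioo l r, ∀ t ∈ J, ContDiffAt ℝ 2 (fun x' => u x' t) x
  heat : ∀ x ∈ Ioo l r, ∀ t ∈ J,
    deriv (fun t' => u x t') t = iteratedDeriv 2 (fun x' => u x' t) x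

/-- The DNWR iteration for the error equations of the heat equation on `(-a, b)`, with Dirichlet
subdomain `(-a, 0)`, Neumann subdomain `(0, b)` and relaxation parameter `θ`, on the time window
`J`. Here `h k` is the `k`-th interface function and `u₁ k x t`, `u₂ k x t` (for `1 ≤ k`) are the
subdomain solutions. As the outward normals at the interface are opposite, the Neumann condition
equates the one-sided derivatives in `x`. -/
structure IsClassicalIteration (a b θ : ℝ) (J : Set ℝ) (h : ℕ → ℝ → ℝ)
    (u₁ u₂ : ℕ → ℝ → ℝ → ℝ) : Prop where
  /-- The Dirichlet step. -/
  heat₁ : ∀ k, SolvesHeat (-a) 0 J (u₁ (k + 1))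
  outer₁ : ∀ k, ∀ t ∈ J, u₁ (k + 1) (-a) t = 0
  dirichlet : ∀ k, ∀ t ∈ J, u₁ (k + 1) 0 t = h k t
  /-- The Neumann step. -/
  heat₂ : ∀ k, SolvesHeat 0 b J (u₂ (k + 1))
  outer₂ : ∀ k, ∀ t ∈ J, u₂ (k + 1) b t = 0
  differentiable₁ : ∀ k, ∀ t ∈ J,
    DifferentiableWithinAt ℝ (fun x => u₁ (k + 1) x t) (Icc (-a) 0) 0
  differentiable₂ : ∀ k, ∀ t ∈ J,
    DifferentiableWithinAt ℝ (fun x => u₂ (k + 1) x t) (Icc 0 b) 0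
  neumann : ∀ k, ∀ t ∈ J,
    derivWithin (fun x => u₂ (k + 1) x t) (Icc 0 b) 0 =
      derivWithin (fun x => u₁ (k + 1) x t) (Icc (-a) 0) 0
  /-- The update of the interface function. -/
  update : ∀ k, ∀ t ∈ J, h (k + 1) t = θ * u₂ (k + 1) 0 t + (1 - θ) * h k t

end DNWR

end

/-!
# Linear and superlinear convergence of Dirichlet–Neumann waveform relaxation

Throughout `ρ = (a - b) / a`, and `erfcHeat y t = erfc (y / (2 √t))` is the probability that a
Brownian motion with generator `∂ₓₓ` reaches the level `y` before time `t`; its time derivative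
`passageDensity y` has the Laplace transform `e^{-y √s}`.

**Classical solutions.** Reflect the Dirichlet solution across the interface and add the Neumann
solution: `w(x, t) = u₂(x, t) + u₁(-x, t)` solves the heat equation on `(0, b)`, has no flux at the
interface because the two one-sided derivatives agree, and satisfies `w(0, ·) = 2 h^{k+1}` and
`w(b, ·) = u₁(-b, ·)`. Both estimates are then comparisons (`maximum_principle_singular`, a weak
maximum principle that tolerates bounded discontinuities at `x = 0`, `t = 0`). If `|h^k| ≤ m` with
`m` nondecreasing in time, the supersolution `(x + a) / a * m(t)` gives `|u₁(-b, ·)| ≤ ρ m`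
(`dirichlet_bound`), and any nonnegative solution on `(0, b)` that has no flux at the interface and
dominates `ρ m` at `x = b` dominates `|w|` (`neumann_bound`). A constant gives the factor `ρ / 2`;
for `m = C erfcHeat (k b)` the solution
`ρ C (erfcHeat ((k + 1) b - x) + erfcHeat ((k + 1) b + x))` gives the superlinear bound.

**Transformed iteration.** Solving the transformed problems (`SolvesODE.wronskian`) shows that one
step multiplies `ĥ` by
`sinh ((a - b) √s) / sinh (a √s) * 1 / (2 cosh (b √s))`, so by injectivity of the Laplace transform
it is the convolution with `r = imageKernel a b` and then with `q = imageKernel (2 b) b`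
(`IsLaplaceIteration.ae_eq_interfaceStep`); conversely these convolutions construct an iteration.
Both kernels are instances of the exit density of a Brownian motion from an interval. Their
integrals are read off from the transforms as `∫ r ≤ ρ` and `∫ q ≤ 1 / 2`, once they are known to be
nonnegative. This is the one delicate point: the image series of the kernel is an odd theta
function, whose functional equation turns it into a sine series that vanishes at the end points,
and the maximum principle applies to that (`sineSeries_nonneg`). The superlinear bound uses in
addition `q ≤ passageDensity b` (`imageKernel_two_mul_le`) and the semigroup property
`passageDensity b * erfcHeat y = erfcHeat (b + y)`.
-/

namespace DNWR

open Filter Topology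

/-! ### Second derivatives and the heat operator -/

theorem iteratedDeriv_two_nonpos_of_isLocalMax {f : ℝ → ℝ} {x : ℝ} (hf : ContDiffAt ℝ 2 f x)
    (hx : IsLocalMax f x) : iteratedDeriv 2 f x ≤ 0 := by
  by_contra! hpos
  rw [iteratedDeriv_succ, iteratedDeriv_one] at hpos
  have hmin : IsLocalMin f x :=
    isLocalMin_of_deriv_deriv_pos hpos hx.deriv_eq_zero hf.continuousAt
  have hconst : f =ᶠ[𝓝 x] fun _ => f x := by
    filter_upwards [hmin, hx] with y h₁ h₂ using le_antisymm h₂ h₁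
  have : deriv (deriv f) x = 0 := by
    rw [hconst.deriv.deriv_eq]; simp
  exact hpos.ne' this

/-- The function `v x t` of space and time is regular enough at `(x, t)` for the heat equation:
differentiable in `t` and of class `C²` in `x`. -/
structure IsRegularAt (v : ℝ → ℝ → ℝ) (x t : ℝ) : Prop where
  time : DifferentiableAt ℝ (fun t' => v x t') t
  space : ContDiffAt ℝ 2 (fun x' => v x' t) x

/-- The heat operator `∂ₜ v - ∂ₓₓ v` at `(x, t)`. -/
noncomputable def heatOp (v : ℝ → ℝ → ℝ) (x t : ℝ) : ℝ :=
  deriv (fun t' => v x t') t - iteratedDeriv 2 (fun x' => v x' t) x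

section HeatOp

variable {v w : ℝ → ℝ → ℝ} {x t : ℝ}

theorem IsRegularAt.add (hv : IsRegularAt v x t) (hw : IsRegularAt w x t) :
    IsRegularAt (fun x t => v x t + w x t) x t :=
  ⟨hv.time.add hw.time, hv.space.add hw.space⟩

theorem IsRegularAt.sub (hv : IsRegularAt v x t) (hw : IsRegularAt w x t) :
    IsRegularAt (fun x t => v x t - w x t) x t :=
  ⟨hv.time.sub hw.time, hv.space.sub hw.space⟩

theorem IsRegularAt.const_mul (hv : IsRegularAt v x t) (c : ℝ) :
    IsRegularAt (fun x t => c * v x t) x t :=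
  ⟨hv.time.const_mul c, contDiffAt_const.mul hv.space⟩

theorem heatOp_add (hv : IsRegularAt v x t) (hw : IsRegularAt w x t) :
    heatOp (fun x t => v x t + w x t) x t = heatOp v x t + heatOp w x t := by
  simp only [heatOp]
  rw [deriv_fun_add hv.time hw.time, iteratedDeriv_fun_add hv.space hw.space]
  ring

theorem heatOp_sub (hv : IsRegularAt v x t) (hw : IsRegularAt w x t) :
    heatOp (fun x t => v x t - w x t) x t = heatOp v x t - heatOp w x t := by
  simp only [heatOp]
  rw [deriv_fun_sub hv.time hw.time, iteratedDeriv_fun_sub hv.space hw.space]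
  ring

theorem heatOp_const_mul (hv : IsRegularAt v x t) (c : ℝ) :
    heatOp (fun x t => c * v x t) x t = c * heatOp v x t := by
  simp only [heatOp]
  rw [deriv_const_mul c hv.time, iteratedDeriv_const_mul_field]
  ring

/-- Reflecting the space variable leaves the heat operator unchanged. -/
theorem IsRegularAt.comp_const_sub {c : ℝ} (hv : IsRegularAt v (c - x) t) :
    IsRegularAt (fun x t => v (c - x) t) x t :=
  ⟨hv.time, ContDiffAt.comp (g := fun x' => v x' t) x hv.space (by fun_prop)⟩

theorem heatOp_comp_const_sub (c : ℝ) :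
    heatOp (fun x t => v (c - x) t) x t = heatOp v (c - x) t := by
  simp only [heatOp]
  rw [iteratedDeriv_comp_const_sub 2 (fun x' => v x' t) c]
  simp

theorem IsRegularAt.comp_const_add {c : ℝ} (hv : IsRegularAt v (c + x) t) :
    IsRegularAt (fun x t => v (c + x) t) x t :=
  ⟨hv.time, ContDiffAt.comp (g := fun x' => v x' t) x hv.space (by fun_prop)⟩

theorem heatOp_comp_const_add (c : ℝ) :
    heatOp (fun x t => v (c + x) t) x t = heatOp v (c + x) t := by
  simp only [heatOp]
  rw [iteratedDeriv_comp_const_add 2 (fun x' => v x' t) c]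

end HeatOp

/-! ### The weak maximum principle -/

theorem deriv_nonpos_of_forall_le_left {f : ℝ → ℝ} {D l r : ℝ} (hlr : l < r)
    (hf : HasDerivWithinAt f D (Icc l r) l) (hmax : ∀ x ∈ Icc l r, f x ≤ f l) : D ≤ 0 := by
  rw [hasDerivWithinAt_iff_tendsto_slope, Icc_sdiff_left] at hf
  have : (𝓝[Ioc l r] l).NeBot := by
    rw [nhdsWithin_Ioc_eq_nhdsGT hlr]; infer_instance
  refine le_of_tendsto hf ?_
  filter_upwards [self_mem_nhdsWithin] with x hx
  rw [slope_def_field]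
  exact div_nonpos_of_nonpos_of_nonneg (by linarith [hmax x ⟨hx.1.le, hx.2⟩]) (by linarith [hx.1])

theorem deriv_nonneg_of_forall_le_right {f : ℝ → ℝ} {D l r : ℝ} (hlr : l < r)
    (hf : HasDerivAt f D r) (hmax : ∀ x ∈ Icc l r, f x ≤ f r) : 0 ≤ D := by
  replace hf := hf.hasDerivWithinAt (s := Icc l r)
  rw [hasDerivWithinAt_iff_tendsto_slope, Icc_sdiff_right] at hf
  have : (𝓝[Ico l r] r).NeBot := by
    rw [nhdsWithin_Ico_eq_nhdsLT hlr]; infer_instance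
  refine ge_of_tendsto hf ?_
  filter_upwards [self_mem_nhdsWithin] with x hx
  rw [slope_def_field]
  exact div_nonneg_of_nonpos (by linarith [hmax x ⟨hx.1, hx.2.le⟩]) (by linarith [hx.2])

/-- Weak maximum principle for the heat equation on `[l, r] × (0, τ]`, with a Dirichlet condition
at `r` and a Dirichlet or Neumann condition at `l`. The initial condition is a bound on the upper
limit at each point of the initial line, which allows functions that are discontinuous there. -/
theorem maximum_principle {v : ℝ → ℝ → ℝ} {l r τ : ℝ}
    (hc : ContinuousOn (fun p : ℝ × ℝ => v p.1 p.2) (Icc l r ×ˢ Ioc 0 τ))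
    (hinit : ∀ x ∈ Icc l r, ∀ ε > 0,
      ∀ᶠ p in 𝓝[Icc l r ×ˢ Ioc 0 τ] ((x, 0) : ℝ × ℝ), v p.1 p.2 < ε)
    (hleft : ∀ t ∈ Ioc 0 τ, v l t ≤ 0 ∨
      ∃ D ≥ 0, HasDerivWithinAt (fun x => v x t) D (Icc l r) l)
    (hright : ∀ t ∈ Ioc 0 τ, v r t ≤ 0)
    (hreg : ∀ x ∈ Ioo l r, ∀ t ∈ Ioc 0 τ, IsRegularAt v x t)
    (hop : ∀ x ∈ Ioo l r, ∀ t ∈ Ioc 0 τ, heatOp v x t ≤ 0) :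
    ∀ x ∈ Icc l r, ∀ t ∈ Ioc 0 τ, v x t ≤ 0 := by
  intro x₀ hx₀ t₀ ht₀
  by_contra! hpos
  have hlr : l ≤ r := hx₀.1.trans hx₀.2
  have hτ : 0 < τ := ht₀.1.trans_le ht₀.2
  have hC : 0 < 1 + τ + (r - l) := by linarith
  set ε := v x₀ t₀ / (2 * (1 + τ + (r - l))) with hε
  have hε0 : 0 < ε := by positivity
  have hεC : ε * (1 + τ + (r - l)) = v x₀ t₀ / 2 := by rw [hε]; field_simp
  -- Up to a short time `δ` the function is below `ε`.
  obtain ⟨δ, hδ, hδτ, hsmall⟩ : ∃ δ > 0, δ ≤ τ ∧ ∀ t ∈ Ioc 0 δ, ∀ x ∈ Icc l r, v x t < ε := by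
    have := isCompact_Icc.eventually_forall_of_forall_eventually (K := Icc l r) (x₀ := (0 : ℝ))
      (P := fun t x => (x, t) ∈ Icc l r ×ˢ Ioc 0 τ → v x t < ε)
      (fun x hx => (continuous_swap.tendsto ((0 : ℝ), x)).eventually
        (eventually_nhdsWithin_iff.mp (hinit x hx ε hε0)))
    obtain ⟨δ, hδ, hball⟩ := Metric.eventually_nhds_iff.mp this
    refine ⟨min (δ / 2) τ, by positivity, min_le_right _ _, fun t ht x hx => ?_⟩
    refine hball ?_ x hx ⟨hx, ht.1, ht.2.trans (min_le_right _ _)⟩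
    rw [Real.dist_eq, sub_zero, abs_of_pos ht.1]
    linarith [ht.2.trans (min_le_left _ _)]
  -- The perturbed function has negative heat operator and positive slope, so its maximum over
  -- `[l, r] × [δ, τ]` can be attained nowhere.
  set V : ℝ → ℝ → ℝ := fun x t => v x t - ε * (1 + t + (r - x)) with hV
  have hsub : Icc l r ×ˢ Icc δ τ ⊆ Icc l r ×ˢ Ioc 0 τ :=
    prod_mono le_rfl fun t ht => ⟨hδ.trans_le ht.1, ht.2⟩
  have hg : ∀ x ∈ Icc l r, ∀ t, 0 < t → 1 ≤ 1 + t + (r - x) := fun x hx t ht => by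
    linarith [hx.2]
  have hδt₀ : δ < t₀ := by
    by_contra! hle
    have h₁ := hsmall t₀ ⟨ht₀.1, hle⟩ x₀ hx₀
    nlinarith
  have hV₀ : 0 < V x₀ t₀ := by
    have : ε * (1 + t₀ + (r - x₀)) ≤ ε * (1 + τ + (r - l)) :=
      mul_le_mul_of_nonneg_left (by linarith [ht₀.2, hx₀.1]) hε0.le
    simp only [hV]; linarith
  obtain ⟨⟨x₁, t₁⟩, ⟨hx₁, ht₁⟩, hmax⟩ := (isCompact_Icc.prod isCompact_Icc).exists_isMaxOn
    (⟨(x₀, t₀), hx₀, hδt₀.le, ht₀.2⟩ : (Icc l r ×ˢ Icc δ τ).Nonempty)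
    (f := fun p => V p.1 p.2) ((hc.mono hsub).sub (by fun_prop))
  simp only at hx₁ ht₁
  have hmax' : ∀ x ∈ Icc l r, ∀ t ∈ Icc δ τ, V x t ≤ V x₁ t₁ := fun x hx t ht =>
    hmax (a := (x, t)) ⟨hx, ht⟩
  have ht₁' : t₁ ∈ Ioc 0 τ := ⟨hδ.trans_le ht₁.1, ht₁.2⟩
  have hV₁ : 0 < V x₁ t₁ := hV₀.trans_le (hmax' x₀ hx₀ t₀ ⟨hδt₀.le, ht₀.2⟩)
  have hεg : ε ≤ ε * (1 + t₁ + (r - x₁)) := le_mul_of_one_le_right hε0.le (hg x₁ hx₁ t₁ ht₁'.1)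
  have hv₁ : ε < v x₁ t₁ := by simp only [hV] at hV₁; linarith
  have hδt₁ : δ < t₁ := by
    by_contra! hle
    exact (hsmall t₁ ⟨ht₁'.1, hle⟩ x₁ hx₁).not_gt hv₁
  have hx₁r : x₁ < r := by
    refine hx₁.2.lt_of_ne fun h => ?_
    have := hright t₁ ht₁'
    rw [← h] at this; linarith
  have hlx₁ : l < x₁ := by
    refine hx₁.1.lt_of_ne fun h => ?_
    subst h
    rcases hleft t₁ ht₁' with h | ⟨D, hD, hder⟩
    · linarith
    have hVd : HasDerivWithinAt (fun x => V x t₁) (D - ε * (0 - 1)) (Icc l r) l :=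
      hder.sub ((((hasDerivWithinAt_id l _).const_sub r).const_add (1 + t₁)).const_mul ε
        |>.congr_deriv (by ring))
    have := deriv_nonpos_of_forall_le_left hx₁r hVd fun x hx => hmax' x hx t₁ ht₁
    linarith
  have hR := hreg x₁ ⟨hlx₁, hx₁r⟩ t₁ ht₁'
  have htime : 0 ≤ deriv (fun t => v x₁ t) t₁ - ε * 1 := by
    refine deriv_nonneg_of_forall_le_right (f := fun t => V x₁ t) hδt₁ ?_ fun t ht =>
      hmax' x₁ hx₁ t ⟨ht.1, ht.2.trans ht₁.2⟩
    exact hR.time.hasDerivAt.sub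
      ((((hasDerivAt_id t₁).const_add 1).add_const (r - x₁)).const_mul ε)
  have hspace : iteratedDeriv 2 (fun x => v x t₁) x₁ ≤ 0 := by
    have hlin : ContDiffAt ℝ 2 (fun x => ε * (1 + t₁ + (r - x))) x₁ := by fun_prop
    have hlin2 : iteratedDeriv 2 (fun x => ε * (1 + t₁ + (r - x))) x₁ = 0 := by
      have : deriv (fun x => ε * (1 + t₁ + (r - x))) = fun _ => -ε := by
        funext x
        exact ((((hasDerivAt_id x).const_sub r).const_add (1 + t₁)).const_mul ε).deriv.trans
          (by ring)
      rw [iteratedDeriv_succ, iteratedDeriv_one, this]; simp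
    have hloc : IsLocalMax (fun x => V x t₁) x₁ := by
      filter_upwards [Icc_mem_nhds hlx₁ hx₁r] with x hx using hmax' x hx t₁ ht₁
    have := iteratedDeriv_two_nonpos_of_isLocalMax (hR.space.sub hlin) hloc
    rw [iteratedDeriv_fun_sub hR.space hlin, hlin2, sub_zero] at this
    exact this
  have := hop x₁ ⟨hlx₁, hx₁r⟩ t₁ ht₁'
  rw [heatOp] at this
  linarith

/-! ### The complementary error function -/

theorem integrable_exp_neg_sq : Integrable fun z : ℝ => Real.exp (-z ^ 2) := by
  simpa using integrable_exp_neg_mul_sq one_pos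

theorem erfc_eq_one_sub (x : ℝ) :
    erfc x = 1 - 2 / √Real.pi * ∫ z in (0 : ℝ)..x, Real.exp (-z ^ 2) := by
  have h := intervalIntegral.integral_interval_add_Ioi (a := (0 : ℝ)) (b := x)
    integrable_exp_neg_sq.integrableOn integrable_exp_neg_sq.integrableOn
  have h0 : ∫ z in Ioi (0 : ℝ), Real.exp (-z ^ 2) = √Real.pi / 2 := by
    simpa using integral_gaussian_Ioi 1
  have hπ : √Real.pi ≠ 0 := by positivity
  rw [h0] at h
  rw [erfc, eq_sub_of_add_eq' h]
  field_simp

theorem hasDerivAt_erfc (x : ℝ) :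
    HasDerivAt erfc (-(2 / √Real.pi * Real.exp (-x ^ 2))) x := by
  have h : HasDerivAt (fun x => ∫ z in (0 : ℝ)..x, Real.exp (-z ^ 2)) (Real.exp (-x ^ 2)) x :=
    (Continuous.integral_hasStrictDerivAt (by fun_prop) 0 x).hasDerivAt
  have := (h.const_mul (2 / √Real.pi)).const_sub 1
  exact this.congr_of_eventuallyEq (Eventually.of_forall erfc_eq_one_sub)

theorem continuous_erfc : Continuous erfc :=
  continuous_iff_continuousAt.mpr fun x => (hasDerivAt_erfc x).continuousAt

theorem erfc_zero : erfc 0 = 1 := by simp [erfc_eq_one_sub]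

theorem erfc_neg (x : ℝ) : erfc (-x) = 2 - erfc x := by
  have h : ∫ z in (0 : ℝ)..-x, Real.exp (-z ^ 2) = -∫ z in (0 : ℝ)..x, Real.exp (-z ^ 2) := by
    have := intervalIntegral.integral_comp_neg (a := (0 : ℝ)) (b := x)
      (fun z : ℝ => Real.exp (-z ^ 2))
    simp only [neg_sq, neg_zero] at this
    rw [this, intervalIntegral.integral_symm]
  rw [erfc_eq_one_sub, erfc_eq_one_sub, h]
  ring

theorem antitone_erfc : Antitone erfc :=
  antitone_of_deriv_nonpos (fun x => (hasDerivAt_erfc x).differentiableAt) fun x => by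
    rw [(hasDerivAt_erfc x).deriv]
    exact neg_nonpos.mpr (by positivity)

theorem tendsto_erfc_atTop : Tendsto erfc atTop (𝓝 0) := by
  have h := intervalIntegral_tendsto_integral_Ioi (0 : ℝ)
    (integrable_exp_neg_sq.integrableOn (s := Ioi 0)) tendsto_id
  have h0 : ∫ z in Ioi (0 : ℝ), Real.exp (-z ^ 2) = √Real.pi / 2 := by
    simpa using integral_gaussian_Ioi 1
  rw [h0] at h
  have := (h.const_mul (2 / √Real.pi)).const_sub 1
  have hπ : √Real.pi ≠ 0 := by positivity
  refine (this.congr fun x => (erfc_eq_one_sub x).symm).trans_eq ?_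
  congr 1
  field_simp
  ring

theorem tendsto_erfc_atBot : Tendsto erfc atBot (𝓝 2) := by
  have := (tendsto_erfc_atTop.comp tendsto_neg_atBot_atTop).const_sub 2
  rw [sub_zero] at this
  refine this.congr fun x => ?_
  simp [erfc_neg]

theorem erfc_pos (x : ℝ) : 0 < erfc x := by
  have hanti : StrictAnti erfc := strictAnti_of_deriv_neg fun x => by
    rw [(hasDerivAt_erfc x).deriv]
    exact neg_neg_of_pos (by positivity)
  exact (antitone_erfc.le_of_tendsto tendsto_erfc_atTop (x + 1)).trans_lt (hanti (lt_add_one x))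

/-! ### Self-similar solutions of the heat equation -/

/-- The solution `erfc (ξ / (2 √t))` of the heat equation. For `ξ > 0` it is the probability that
a Brownian motion with generator `∂ₓₓ` reaches the level `ξ` before time `t`. -/
noncomputable def erfcHeat (ξ t : ℝ) : ℝ := erfc (ξ / (2 * √t))

/-- The time derivative of `erfcHeat`, which for `ξ > 0` is the density of the first passage time
of the level `ξ`. As a function of `ξ` it is odd. -/
noncomputable def passageDensity (ξ t : ℝ) : ℝ :=
  ξ / (2 * √Real.pi * (t * √t)) * Real.exp (-(ξ ^ 2 / (4 * t)))

theorem sq_div_two_mul_sqrt (ξ : ℝ) {t : ℝ} (ht : 0 < t) :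
    (ξ / (2 * √t)) ^ 2 = ξ ^ 2 / (4 * t) := by
  rw [div_pow, mul_pow, Real.sq_sqrt ht.le]; norm_num

theorem hasDerivAt_erfcHeat_space (ξ : ℝ) {t : ℝ} (ht : 0 < t) :
    HasDerivAt (fun ξ => erfcHeat ξ t) (-(1 / √(Real.pi * t)) * Real.exp (-(ξ ^ 2 / (4 * t)))) ξ := by
  have h := (hasDerivAt_erfc (ξ / (2 * √t))).comp ξ ((hasDerivAt_id ξ).div_const (2 * √t))
  refine h.congr_deriv ?_
  have : √t ≠ 0 := by positivity
  rw [sq_div_two_mul_sqrt ξ ht, Real.sqrt_mul Real.pi_pos.le]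
  field_simp

theorem hasDerivAt_erfcHeat_space_deriv (ξ : ℝ) {t : ℝ} (ht : 0 < t) :
    HasDerivAt (fun ξ => -(1 / √(Real.pi * t)) * Real.exp (-(ξ ^ 2 / (4 * t))))
      (passageDensity ξ t) ξ := by
  have h := (((((hasDerivAt_id ξ).pow 2).div_const (4 * t)).neg).exp).const_mul
    (-(1 / √(Real.pi * t)))
  refine h.congr_deriv ?_
  have h1 : √t ≠ 0 := by positivity
  have h2 : √Real.pi ≠ 0 := by positivity
  rw [Real.sqrt_mul Real.pi_pos.le, passageDensity]
  simp
  field_simp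
  ring

theorem hasDerivAt_erfcHeat_time (ξ : ℝ) {t : ℝ} (ht : 0 < t) :
    HasDerivAt (fun t => erfcHeat ξ t) (passageDensity ξ t) t := by
  have hs : √t ≠ 0 := by positivity
  have h1 := ((Real.hasDerivAt_sqrt ht.ne').const_mul 2).inv (by positivity) |>.const_mul ξ
  have h := (hasDerivAt_erfc (ξ / (2 * √t))).comp t h1
  refine h.congr_deriv ?_
  rw [sq_div_two_mul_sqrt ξ ht, passageDensity]
  have h2 : √Real.pi ≠ 0 := by positivity
  have h3 : √t ^ 2 = t := Real.sq_sqrt ht.le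
  field_simp
  rw [h3]

theorem isRegularAt_erfcHeat (ξ : ℝ) {t : ℝ} (ht : 0 < t) : IsRegularAt erfcHeat ξ t := by
  refine ⟨(hasDerivAt_erfcHeat_time ξ ht).differentiableAt, ContDiff.contDiffAt ?_⟩
  have hd : deriv (fun ξ => erfcHeat ξ t) = _ :=
    funext fun ξ => (hasDerivAt_erfcHeat_space ξ ht).deriv
  rw [show (2 : WithTop ℕ∞) = 1 + 1 by norm_num, contDiff_succ_iff_deriv]
  refine ⟨fun ξ => (hasDerivAt_erfcHeat_space ξ ht).differentiableAt, by simp, ?_⟩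
  rw [hd]
  fun_prop

theorem heatOp_erfcHeat (ξ : ℝ) {t : ℝ} (ht : 0 < t) : heatOp erfcHeat ξ t = 0 := by
  have hd : deriv (fun ξ => erfcHeat ξ t) = _ :=
    funext fun ξ => (hasDerivAt_erfcHeat_space ξ ht).deriv
  rw [heatOp, iteratedDeriv_succ, iteratedDeriv_one, hd,
    (hasDerivAt_erfcHeat_space_deriv ξ ht).deriv, (hasDerivAt_erfcHeat_time ξ ht).deriv, sub_self]

theorem continuousAt_erfcHeat {p : ℝ × ℝ} (hp : 0 < p.2) :
    ContinuousAt (fun p : ℝ × ℝ => erfcHeat p.1 p.2) p := by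
  refine continuous_erfc.continuousAt.comp ?_
  exact continuousAt_fst.div (by fun_prop) (by positivity)

theorem erfcHeat_pos (ξ t : ℝ) : 0 < erfcHeat ξ t := erfc_pos _

theorem erfcHeat_antitone (t : ℝ) : Antitone fun ξ => erfcHeat ξ t := fun ξ η h =>
  antitone_erfc (by gcongr)

theorem erfcHeat_mono {ξ s t : ℝ} (hξ : 0 ≤ ξ) (hs : 0 < s) (hst : s ≤ t) :
    erfcHeat ξ s ≤ erfcHeat ξ t :=
  antitone_erfc (by gcongr)

theorem erfcHeat_zero (t : ℝ) : erfcHeat 0 t = 1 := by simp [erfcHeat, erfc_zero]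

theorem passageDensity_nonneg {ξ t : ℝ} (hξ : 0 ≤ ξ) (ht : 0 ≤ t) : 0 ≤ passageDensity ξ t := by
  unfold passageDensity; positivity

/-! ### A barrier at a singular boundary point -/

/-- The solution of the heat equation on the line whose initial value is `2` on `(-δ, δ)` and `0`
outside. It dominates bounded functions near the origin, and tends to `0` with `δ` elsewhere. -/
noncomputable def pointBarrier (δ x t : ℝ) : ℝ := erfcHeat (-δ + x) t - erfcHeat (δ + x) t

theorem pointBarrier_nonneg {δ : ℝ} (hδ : 0 ≤ δ) (x t : ℝ) : 0 ≤ pointBarrier δ x t :=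
  sub_nonneg.mpr (erfcHeat_antitone t (by linarith))

theorem isRegularAt_pointBarrier (δ x : ℝ) {t : ℝ} (ht : 0 < t) :
    IsRegularAt (pointBarrier δ) x t :=
  (isRegularAt_erfcHeat _ ht).comp_const_add.sub (isRegularAt_erfcHeat _ ht).comp_const_add

theorem heatOp_pointBarrier (δ x : ℝ) {t : ℝ} (ht : 0 < t) :
    heatOp (pointBarrier δ) x t = 0 := by
  refine (heatOp_sub (isRegularAt_erfcHeat _ ht).comp_const_add
    (isRegularAt_erfcHeat _ ht).comp_const_add).trans ?_
  rw [heatOp_comp_const_add, heatOp_comp_const_add, heatOp_erfcHeat _ ht, heatOp_erfcHeat _ ht,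
    sub_self]

theorem continuousAt_pointBarrier (δ : ℝ) {p : ℝ × ℝ} (hp : 0 < p.2) :
    ContinuousAt (fun p : ℝ × ℝ => pointBarrier δ p.1 p.2) p := by
  have h : ∀ c : ℝ, ContinuousAt (fun p : ℝ × ℝ => erfcHeat (c + p.1) p.2) p := fun c =>
    (continuousAt_erfcHeat (p := (c + p.1, p.2)) hp).comp
      (f := fun p : ℝ × ℝ => (c + p.1, p.2)) (by fun_prop)
  exact (h _).sub (h _)

theorem hasDerivAt_pointBarrier_zero (δ : ℝ) {t : ℝ} (ht : 0 < t) :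
    HasDerivAt (fun x => pointBarrier δ x t) 0 0 := by
  have h : ∀ c : ℝ, HasDerivAt (fun x => erfcHeat (c + x) t) _ 0 := fun c =>
    (hasDerivAt_erfcHeat_space (c + 0) ht).comp_const_add c 0
  refine ((h _).sub (h _)).congr_deriv ?_
  simp

theorem tendsto_pointBarrier (x t : ℝ) :
    Tendsto (fun δ => pointBarrier δ x t) (𝓝[>] 0) (𝓝 0) := by
  have h : Continuous fun ξ => erfcHeat ξ t :=
    continuous_erfc.comp (continuous_id.div_const _)
  have : Continuous fun δ => pointBarrier δ x t := by
    unfold pointBarrier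
    exact (h.comp (by fun_prop)).sub (h.comp (by fun_prop))
  refine ((this.tendsto 0).mono_left nhdsWithin_le_nhds).trans_eq ?_
  simp [pointBarrier]

theorem one_lt_pointBarrier_near_zero {δ : ℝ} (hδ : 0 < δ) {s : Set (ℝ × ℝ)}
    (hs : ∀ p ∈ s, 0 < p.2) :
    ∀ᶠ p in 𝓝[s] ((0, 0) : ℝ × ℝ), 1 < pointBarrier δ p.1 p.2 := by
  have hinv : Tendsto (fun p : ℝ × ℝ => (2 * √p.2)⁻¹) (𝓝[s] (0, 0)) atTop := by
    refine tendsto_inv_nhdsGT_zero.comp (tendsto_nhdsWithin_iff.mpr ⟨?_, ?_⟩)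
    · have : Continuous fun p : ℝ × ℝ => 2 * √p.2 := by fun_prop
      refine ((this.tendsto (0, 0)).mono_left nhdsWithin_le_nhds).trans_eq (by simp)
    · filter_upwards [self_mem_nhdsWithin] with p hp
      have := hs p hp
      exact mem_Ioi.mpr (by positivity)
  have hfst : ∀ c : ℝ, Tendsto (fun p : ℝ × ℝ => c + p.1) (𝓝[s] (0, 0)) (𝓝 c) := fun c => by
    have : Continuous fun p : ℝ × ℝ => c + p.1 := by fun_prop
    refine ((this.tendsto (0, 0)).mono_left nhdsWithin_le_nhds).trans_eq (by simp)
  have h₁ : Tendsto (fun p : ℝ × ℝ => erfcHeat (-δ + p.1) p.2) (𝓝[s] (0, 0)) (𝓝 2) :=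
    tendsto_erfc_atBot.comp ((hfst (-δ)).neg_mul_atTop (by linarith) hinv)
  have h₂ : Tendsto (fun p : ℝ × ℝ => erfcHeat (δ + p.1) p.2) (𝓝[s] (0, 0)) (𝓝 0) :=
    tendsto_erfc_atTop.comp ((hfst δ).pos_mul_atTop hδ hinv)
  exact (h₁.sub h₂).eventually (lt_mem_nhds (by norm_num))

/-! ### Pointwise bounds in the time domain -/

/-- The maximum principle when nothing but boundedness is known near the point `x = 0`, `t = 0`. -/
theorem maximum_principle_singular {v : ℝ → ℝ → ℝ} {l r τ N : ℝ} (hN : 0 ≤ N)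
    (hc : ContinuousOn (fun p : ℝ × ℝ => v p.1 p.2) (Icc l r ×ˢ Ioc 0 τ))
    (hbdd : ∀ x ∈ Icc l r, ∀ t ∈ Ioc 0 τ, v x t ≤ N)
    (hinit : ∀ x ∈ Icc l r, x ≠ 0 → ∀ ε > 0,
      ∀ᶠ p in 𝓝[Icc l r ×ˢ Ioc 0 τ] ((x, 0) : ℝ × ℝ), v p.1 p.2 < ε)
    (hleft : ∀ t ∈ Ioc 0 τ, v l t ≤ 0 ∨
      l = 0 ∧ HasDerivWithinAt (fun x => v x t) 0 (Icc l r) l)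
    (hright : ∀ t ∈ Ioc 0 τ, v r t ≤ 0)
    (hreg : ∀ x ∈ Ioo l r, ∀ t ∈ Ioc 0 τ, IsRegularAt v x t)
    (hop : ∀ x ∈ Ioo l r, ∀ t ∈ Ioc 0 τ, heatOp v x t ≤ 0) :
    ∀ x ∈ Icc l r, ∀ t ∈ Ioc 0 τ, v x t ≤ 0 := by
  have key : ∀ δ > 0, ∀ x ∈ Icc l r, ∀ t ∈ Ioc 0 τ, v x t - N * pointBarrier δ x t ≤ 0 := by
    intro δ hδ
    have hB : ∀ x t, 0 ≤ N * pointBarrier δ x t := fun x t =>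
      mul_nonneg hN (pointBarrier_nonneg hδ.le x t)
    refine maximum_principle (v := fun x t => v x t - N * pointBarrier δ x t)
      ?_ ?_ ?_ ?_ ?_ ?_
    · refine hc.sub (continuousOn_const.mul fun p hp => ?_)
      exact (continuousAt_pointBarrier δ hp.2.1).continuousWithinAt
    · intro x hx ε hε
      rcases eq_or_ne x 0 with rfl | hx0
      · filter_upwards [one_lt_pointBarrier_near_zero hδ (s := Icc l r ×ˢ Ioc 0 τ)
          fun p hp => hp.2.1, self_mem_nhdsWithin] with p hp hpQ
        have := hbdd p.1 hpQ.1 p.2 hpQ.2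
        nlinarith
      · filter_upwards [hinit x hx hx0 ε hε] with p hp
        linarith [hB p.1 p.2]
    · intro t ht
      rcases hleft t ht with h | ⟨rfl, h⟩
      · left; linarith [hB l t]
      · right
        refine ⟨0 - N * 0, by simp, h.sub ?_⟩
        exact ((hasDerivAt_pointBarrier_zero δ ht.1).const_mul N).hasDerivWithinAt
    · intro t ht
      linarith [hB r t, hright t ht]
    · intro x hx t ht
      exact (hreg x hx t ht).sub ((isRegularAt_pointBarrier δ x ht.1).const_mul N)
    · intro x hx t ht
      rw [heatOp_sub (hreg x hx t ht) ((isRegularAt_pointBarrier δ x ht.1).const_mul N),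
        heatOp_const_mul (isRegularAt_pointBarrier δ x ht.1), heatOp_pointBarrier δ x ht.1]
      simpa using hop x hx t ht
  intro x hx t ht
  have hlim : Tendsto (fun δ => v x t - N * pointBarrier δ x t) (𝓝[>] 0) (𝓝 (v x t - N * 0)) :=
    tendsto_const_nhds.sub ((tendsto_pointBarrier x t).const_mul N)
  have := le_of_tendsto hlim (by
    filter_upwards [self_mem_nhdsWithin] with δ hδ using key δ hδ x hx t ht)
  simpa using this

/-- A set of positive times that contains all earlier positive times. -/
def IsTimeWindow (J : Set ℝ) : Prop := ∀ τ ∈ J, 0 < τ ∧ Ioc 0 τ ⊆ J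

theorem isTimeWindow_Ioi : IsTimeWindow (Ioi 0) := fun _ hτ => ⟨hτ, fun _ ht => ht.1⟩

theorem isTimeWindow_Ioo (T : ℝ) : IsTimeWindow (Ioo 0 T) :=
  fun _ hτ => ⟨hτ.1, fun _ ht => ⟨ht.1, ht.2.trans_lt hτ.2⟩⟩

namespace SolvesHeat

variable {l r τ : ℝ} {J : Set ℝ} {u : ℝ → ℝ → ℝ}

theorem isRegularAt (hu : SolvesHeat l r J u) {x t : ℝ} (hx : x ∈ Ioo l r) (ht : t ∈ J) :
    IsRegularAt u x t :=
  ⟨hu.differentiableAt x hx t ht, hu.contDiffAt x hx t ht⟩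

theorem heatOp_eq_zero (hu : SolvesHeat l r J u) {x t : ℝ} (hx : x ∈ Ioo l r) (ht : t ∈ J) :
    heatOp u x t = 0 :=
  sub_eq_zero.mpr (hu.heat x hx t ht)

theorem continuousOn_window (hu : SolvesHeat l r J u) (hJ : IsTimeWindow J) (hτ : τ ∈ J) :
    ContinuousOn (fun p : ℝ × ℝ => u p.1 p.2) (Icc l r ×ˢ Ioc 0 τ) := by
  refine hu.continuousOn.mono fun p hp => ⟨⟨hp.1, mem_insert_of_mem _ ((hJ τ hτ).2 hp.2)⟩, ?_⟩
  intro h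
  exact hp.2.1.ne' (congrArg Prod.snd h)

theorem tendsto_initial (hu : SolvesHeat l r J u) (hJ : IsTimeWindow J) (hτ : τ ∈ J) {x : ℝ}
    (hx : x ∈ Icc l r) (hx0 : x ≠ 0) :
    Tendsto (fun p : ℝ × ℝ => u p.1 p.2) (𝓝[Icc l r ×ˢ Ioc 0 τ] (x, 0)) (𝓝 0) := by
  have h := hu.continuousOn (x, 0) ⟨⟨hx, mem_insert _ _⟩, fun h => hx0 (congrArg Prod.fst h)⟩
  rw [ContinuousWithinAt, hu.initial x hx hx0] at h
  refine h.mono_left (nhdsWithin_mono _ fun p hp => ?_)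
  refine ⟨⟨hp.1, mem_insert_of_mem _ ((hJ τ hτ).2 hp.2)⟩, fun h => ?_⟩
  exact hp.2.1.ne' (congrArg Prod.snd h)

end SolvesHeat

theorem iteratedDeriv_two_mul_affine (c d e x : ℝ) :
    iteratedDeriv 2 (fun x => (x + c) / d * e) x = 0 := by
  have : deriv (fun x => (x + c) / d * e) = fun _ => 1 / d * e := by
    funext y
    exact ((((hasDerivAt_id y).add_const c).div_const d).mul_const e).deriv
  rw [iteratedDeriv_succ, iteratedDeriv_one, this]; simp

/-- If the interface data are bounded by a nondecreasing function `m` of time, then the solution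
on the Dirichlet subdomain is bounded by the linear profile with interface value `m t`. -/
theorem dirichlet_bound {a τ : ℝ} {J : Set ℝ} {u : ℝ → ℝ → ℝ} {m : ℝ → ℝ} (ha : 0 < a)
    (hJ : IsTimeWindow J) (hτ : τ ∈ J) (hu : SolvesHeat (-a) 0 J u)
    (houter : ∀ t ∈ J, u (-a) t = 0)
    (hm0 : ∀ t ∈ Ioc 0 τ, 0 ≤ m t) (hmd : ∀ t ∈ Ioc 0 τ, DifferentiableAt ℝ m t)
    (hm' : ∀ t ∈ Ioc 0 τ, 0 ≤ deriv m t)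
    (hint : ∀ t ∈ Ioc 0 τ, |u 0 t| ≤ m t) :
    ∀ x ∈ Icc (-a) 0, ∀ t ∈ Ioc 0 τ, |u x t| ≤ (x + a) / a * m t := by
  obtain ⟨N, hN⟩ := hu.locallyBounded τ hτ
  have hsubJ := (hJ τ hτ).2
  have hprof : ∀ x ∈ Icc (-a) 0, ∀ t ∈ Ioc 0 τ, 0 ≤ (x + a) / a * m t := fun x hx t ht =>
    mul_nonneg (div_nonneg (by linarith [hx.1]) ha.le) (hm0 t ht)
  have key : ∀ σ : ℝ, |σ| = 1 → ∀ x ∈ Icc (-a) 0, ∀ t ∈ Ioc 0 τ,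
      σ * u x t - (x + a) / a * m t ≤ 0 := by
    intro σ hσ
    have habs : ∀ x t, σ * u x t ≤ |u x t| := fun x t => by
      calc σ * u x t ≤ |σ * u x t| := le_abs_self _
        _ = |u x t| := by rw [abs_mul, hσ, one_mul]
    have hprofreg : ∀ x, ∀ t ∈ Ioc 0 τ, IsRegularAt (fun x t => (x + a) / a * m t) x t :=
      fun x t ht => ⟨(hmd t ht).const_mul _, by fun_prop⟩
    refine maximum_principle_singular (v := fun x t => σ * u x t - (x + a) / a * m t)
      (N := |N|) (abs_nonneg N) ?_ ?_ ?_ ?_ ?_ ?_ ?_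
    · refine (continuousOn_const.mul (hu.continuousOn_window hJ hτ)).sub
        (ContinuousOn.mul (by fun_prop) ?_)
      have : ContinuousOn m (Ioc 0 τ) := fun t ht => (hmd t ht).continuousAt.continuousWithinAt
      exact this.comp continuousOn_snd fun p hp => hp.2
    · intro x hx t ht
      have h1 := hN x hx t (hsubJ ht) ht.2
      linarith [habs x t, hprof x hx t ht, le_abs_self N]
    · intro x hx hx0 ε hε
      have := (hu.tendsto_initial hJ hτ hx hx0).const_mul σ
      rw [mul_zero] at this
      filter_upwards [this.eventually (gt_mem_nhds hε), self_mem_nhdsWithin] with p hp hpQ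
      linarith [hprof p.1 hpQ.1 p.2 hpQ.2]
    · intro t ht
      left
      simp [houter t (hsubJ ht)]
    · intro t ht
      have : (0 + a) / a = 1 := by rw [zero_add, div_self ha.ne']
      rw [this]
      linarith [habs 0 t, hint t ht]
    · intro x hx t ht
      exact ((hu.isRegularAt hx (hsubJ ht)).const_mul σ).sub (hprofreg x t ht)
    · intro x hx t ht
      rw [heatOp_sub ((hu.isRegularAt hx (hsubJ ht)).const_mul σ) (hprofreg x t ht),
        heatOp_const_mul (hu.isRegularAt hx (hsubJ ht)), hu.heatOp_eq_zero hx (hsubJ ht), mul_zero,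
        zero_sub, neg_nonpos, heatOp, iteratedDeriv_two_mul_affine, sub_zero,
        deriv_const_mul _ (hmd t ht)]
      exact mul_nonneg (div_nonneg (by linarith [hx.1]) ha.le) (hm' t ht)
  intro x hx t ht
  have h1 := key 1 (by simp) x hx t ht
  have h2 := key (-1) (by simp) x hx t ht
  rw [abs_le]
  constructor <;> linarith

/-- Reflecting the Dirichlet solution `u₁` across the interface and adding the Neumann solution
`u₂` gives a solution `w` with `∂ₓ w = 0` at the interface. So `w` is controlled by any
nonnegative solution `W` with the same symmetry that dominates it at `x = b`. -/
theorem neumann_bound {a b τ : ℝ} {J : Set ℝ} {u₁ u₂ W : ℝ → ℝ → ℝ} (hb : 0 < b) (hab : b < a)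
    (hJ : IsTimeWindow J) (hτ : τ ∈ J) (hu₁ : SolvesHeat (-a) 0 J u₁) (hu₂ : SolvesHeat 0 b J u₂)
    (houter : ∀ t ∈ J, u₂ b t = 0)
    (hd₁ : ∀ t ∈ J, DifferentiableWithinAt ℝ (fun x => u₁ x t) (Icc (-a) 0) 0)
    (hd₂ : ∀ t ∈ J, DifferentiableWithinAt ℝ (fun x => u₂ x t) (Icc 0 b) 0)
    (hflux : ∀ t ∈ J, derivWithin (fun x => u₂ x t) (Icc 0 b) 0 =
      derivWithin (fun x => u₁ x t) (Icc (-a) 0) 0)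
    (hWc : ContinuousOn (fun p : ℝ × ℝ => W p.1 p.2) (Icc 0 b ×ˢ Ioc 0 τ))
    (hW0 : ∀ x ∈ Icc 0 b, ∀ t ∈ Ioc 0 τ, 0 ≤ W x t)
    (hWreg : ∀ x ∈ Ioo 0 b, ∀ t ∈ Ioc 0 τ, IsRegularAt W x t)
    (hWop : ∀ x ∈ Ioo 0 b, ∀ t ∈ Ioc 0 τ, heatOp W x t = 0)
    (hWd : ∀ t ∈ Ioc 0 τ, HasDerivAt (fun x => W x t) 0 0)
    (hWb : ∀ t ∈ Ioc 0 τ, |u₁ (-b) t| ≤ W b t) :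
    ∀ t ∈ Ioc 0 τ, |u₂ 0 t + u₁ 0 t| ≤ W 0 t := by
  obtain ⟨N₁, hN₁⟩ := hu₁.locallyBounded τ hτ
  obtain ⟨N₂, hN₂⟩ := hu₂.locallyBounded τ hτ
  have hsubJ := (hJ τ hτ).2
  have hmem : ∀ x ∈ Icc 0 b, 0 - x ∈ Icc (-a) 0 := fun x hx =>
    ⟨by linarith [hx.2], by linarith [hx.1]⟩
  have hmem' : ∀ x ∈ Ioo 0 b, 0 - x ∈ Ioo (-a) 0 := fun x hx =>
    ⟨by linarith [hx.2], by linarith [hx.1]⟩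
  have hmaps : MapsTo (fun p : ℝ × ℝ => (0 - p.1, p.2)) (Icc 0 b ×ˢ Ioc 0 τ)
      (Icc (-a) 0 ×ˢ Ioc 0 τ) := fun p hp => ⟨hmem p.1 hp.1, hp.2⟩
  have hwreg : ∀ x ∈ Ioo 0 b, ∀ t ∈ Ioc 0 τ,
      IsRegularAt (fun x t => u₂ x t + u₁ (0 - x) t) x t := fun x hx t ht =>
    (hu₂.isRegularAt hx (hsubJ ht)).add
      (hu₁.isRegularAt (hmem' x hx) (hsubJ ht)).comp_const_sub
  have hwop : ∀ x ∈ Ioo 0 b, ∀ t ∈ Ioc 0 τ,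
      heatOp (fun x t => u₂ x t + u₁ (0 - x) t) x t = 0 := fun x hx t ht => by
    rw [heatOp_add (hu₂.isRegularAt hx (hsubJ ht))
      (hu₁.isRegularAt (hmem' x hx) (hsubJ ht)).comp_const_sub, heatOp_comp_const_sub,
      hu₂.heatOp_eq_zero hx (hsubJ ht), hu₁.heatOp_eq_zero (hmem' x hx) (hsubJ ht), add_zero]
  have hwd : ∀ t ∈ Ioc 0 τ,
      HasDerivWithinAt (fun x => u₂ x t + u₁ (0 - x) t) 0 (Icc 0 b) 0 := fun t ht => by
    have h₂ := (hd₂ t (hsubJ ht)).hasDerivWithinAt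
    have h₁ := (hd₁ t (hsubJ ht)).hasDerivWithinAt
    have h₁' := HasDerivWithinAt.scomp_of_eq (x := (0 : ℝ)) (h := fun x => 0 - x) (s := Icc 0 b)
      h₁ ((hasDerivWithinAt_id (0 : ℝ) _).const_sub 0) (fun x hx => hmem x hx) (sub_zero 0).symm
    refine (h₂.add h₁').congr_deriv ?_
    rw [hflux t (hsubJ ht)]; simp
  have key : ∀ σ : ℝ, |σ| = 1 → ∀ x ∈ Icc 0 b, ∀ t ∈ Ioc 0 τ,
      σ * (u₂ x t + u₁ (0 - x) t) - W x t ≤ 0 := by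
    intro σ hσ
    have habs : ∀ z, σ * z ≤ |z| := fun z => by
      calc σ * z ≤ |σ * z| := le_abs_self _
        _ = |z| := by rw [abs_mul, hσ, one_mul]
    refine maximum_principle_singular (v := fun x t => σ * (u₂ x t + u₁ (0 - x) t) - W x t)
      (N := |N₁| + |N₂|) (by positivity) ?_ ?_ ?_ ?_ ?_ ?_ ?_
    · refine (continuousOn_const.mul ((hu₂.continuousOn_window hJ hτ).add ?_)).sub hWc
      exact (hu₁.continuousOn_window hJ hτ).comp (by fun_prop) hmaps
    · intro x hx t ht
      have h₂ := hN₂ x hx t (hsubJ ht) ht.2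
      have h₁ := hN₁ (0 - x) (hmem x hx) t (hsubJ ht) ht.2
      have := abs_add_le (u₂ x t) (u₁ (0 - x) t)
      linarith [habs (u₂ x t + u₁ (0 - x) t), hW0 x hx t ht, le_abs_self N₁, le_abs_self N₂]
    · intro x hx hx0 ε hε
      have h₁ : Tendsto (fun p : ℝ × ℝ => u₁ (0 - p.1) p.2) (𝓝[Icc 0 b ×ˢ Ioc 0 τ] (x, 0))
          (𝓝 0) := by
        refine (hu₁.tendsto_initial hJ hτ (hmem x hx) (by simpa using hx0)).comp
          (f := fun p : ℝ × ℝ => (0 - p.1, p.2)) ?_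
        refine ContinuousWithinAt.tendsto_nhdsWithin (x := ((x, 0) : ℝ × ℝ)) ?_ hmaps
        fun_prop
      have := ((hu₂.tendsto_initial hJ hτ hx hx0).add h₁).const_mul σ
      rw [add_zero, mul_zero] at this
      filter_upwards [this.eventually (gt_mem_nhds hε), self_mem_nhdsWithin] with p hp hpQ
      linarith [hW0 p.1 hpQ.1 p.2 hpQ.2]
    · intro t ht
      refine Or.inr ⟨rfl, (((hwd t ht).const_mul σ).sub (hWd t ht).hasDerivWithinAt).congr_deriv ?_⟩
      simp
    · intro t ht
      rw [houter t (hsubJ ht), zero_add, zero_sub]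
      linarith [habs (u₁ (-b) t), hWb t ht]
    · intro x hx t ht
      exact ((hwreg x hx t ht).const_mul σ).sub (hWreg x hx t ht)
    · intro x hx t ht
      rw [heatOp_sub ((hwreg x hx t ht).const_mul σ) (hWreg x hx t ht),
        heatOp_const_mul (hwreg x hx t ht), hwop x hx t ht, hWop x hx t ht]
      simp
  intro t ht
  have h1 := key 1 (by simp) 0 ⟨le_rfl, hb.le⟩ t ht
  have h2 := key (-1) (by simp) 0 ⟨le_rfl, hb.le⟩ t ht
  rw [sub_zero] at h1 h2
  rw [abs_le]
  constructor <;> linarith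

/-- One step of the iteration: a bound `m` on the interface function and a barrier `W` that
dominates `(a - b) / a * m` at the outer boundary give the bound `W 0 / 2` on its update. -/
theorem IsClassicalIteration.abs_step_le {a b τ : ℝ} {J : Set ℝ} {h : ℕ → ℝ → ℝ}
    {u₁ u₂ : ℕ → ℝ → ℝ → ℝ} {m : ℝ → ℝ} {W : ℝ → ℝ → ℝ} (hb : 0 < b) (hab : b < a)
    (hJ : IsTimeWindow J) (hτ : τ ∈ J) (hit : IsClassicalIteration a b (1 / 2) J h u₁ u₂) (k : ℕ)
    (hm0 : ∀ t ∈ Ioc 0 τ, 0 ≤ m t) (hmd : ∀ t ∈ Ioc 0 τ, DifferentiableAt ℝ m t)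
    (hm' : ∀ t ∈ Ioc 0 τ, 0 ≤ deriv m t) (hint : ∀ t ∈ J, |h k t| ≤ m t)
    (hWc : ContinuousOn (fun p : ℝ × ℝ => W p.1 p.2) (Icc 0 b ×ˢ Ioc 0 τ))
    (hW0 : ∀ x ∈ Icc 0 b, ∀ t ∈ Ioc 0 τ, 0 ≤ W x t)
    (hWreg : ∀ x ∈ Ioo 0 b, ∀ t ∈ Ioc 0 τ, IsRegularAt W x t)
    (hWop : ∀ x ∈ Ioo 0 b, ∀ t ∈ Ioc 0 τ, heatOp W x t = 0)
    (hWd : ∀ t ∈ Ioc 0 τ, HasDerivAt (fun x => W x t) 0 0)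
    (hWb : ∀ t ∈ Ioc 0 τ, (a - b) / a * m t ≤ W b t) :
    |h (k + 1) τ| ≤ W 0 τ / 2 := by
  have hsubJ := (hJ τ hτ).2
  have hτ0 : τ ∈ Ioc 0 τ := ⟨(hJ τ hτ).1, le_rfl⟩
  have h₁ := dirichlet_bound (hb.trans hab) hJ hτ (hit.heat₁ k) (hit.outer₁ k) hm0 hmd hm'
    fun t ht => by rw [hit.dirichlet k t (hsubJ ht)]; exact hint t (hsubJ ht)
  have h₂ := neumann_bound hb hab hJ hτ (hit.heat₁ k) (hit.heat₂ k) (hit.outer₂ k)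
    (hit.differentiable₁ k) (hit.differentiable₂ k) (hit.neumann k) hWc hW0 hWreg hWop hWd
    (fun t ht => by
      refine (h₁ (-b) ⟨by linarith, by linarith⟩ t ht).trans ?_
      rw [neg_add_eq_sub]
      exact hWb t ht) τ hτ0
  rw [hit.dirichlet k τ hτ] at h₂
  rw [hit.update k τ hτ, show 1 / 2 * u₂ (k + 1) 0 τ + (1 - 1 / 2) * h k τ =
    (u₂ (k + 1) 0 τ + h k τ) / 2 by ring, abs_div, abs_two]
  linarith

theorem IsClassicalIteration.abs_le_linear {a b M : ℝ} {J : Set ℝ} {h : ℕ → ℝ → ℝ}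
    {u₁ u₂ : ℕ → ℝ → ℝ → ℝ} (hb : 0 < b) (hab : b < a) (hJ : IsTimeWindow J)
    (hit : IsClassicalIteration a b (1 / 2) J h u₁ u₂) (hM : ∀ t ∈ J, |h 0 t| ≤ M) (k : ℕ) :
    ∀ t ∈ J, |h k t| ≤ ((a - b) / (2 * a)) ^ k * M := by
  have ha : 0 < a := hb.trans hab
  induction k with
  | zero => simpa using hM
  | succ k ih =>
    intro τ hτ
    have hM0 : 0 ≤ M := (abs_nonneg _).trans (hM τ hτ)
    have hρ : 0 ≤ (a - b) / (2 * a) := div_nonneg (by linarith) (by linarith)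
    have hm : 0 ≤ ((a - b) / (2 * a)) ^ k * M := by positivity
    have hW : 0 ≤ (a - b) / a * (((a - b) / (2 * a)) ^ k * M) :=
      mul_nonneg (div_nonneg (by linarith) ha.le) hm
    have := hit.abs_step_le (m := fun _ => ((a - b) / (2 * a)) ^ k * M)
      (W := fun _ _ => (a - b) / a * (((a - b) / (2 * a)) ^ k * M)) hb hab hJ hτ k
      (fun _ _ => hm) (fun _ _ => by fun_prop) (fun _ _ => by simp) ih (by fun_prop)
      (fun _ _ _ _ => hW) (fun _ _ _ _ => ⟨by fun_prop, by fun_prop⟩)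
      (fun _ _ _ _ => by simp [heatOp, iteratedDeriv_const]) (fun _ _ => hasDerivAt_const _ _)
      (fun _ _ => le_rfl)
    refine this.trans_eq ?_
    rw [pow_succ]; field_simp

theorem IsClassicalIteration.abs_le_superlinear {a b M : ℝ} {J : Set ℝ} {h : ℕ → ℝ → ℝ}
    {u₁ u₂ : ℕ → ℝ → ℝ → ℝ} (hb : 0 < b) (hab : b < a) (hJ : IsTimeWindow J)
    (hit : IsClassicalIteration a b (1 / 2) J h u₁ u₂) (hM : ∀ t ∈ J, |h 0 t| ≤ M) (k : ℕ) :
    ∀ t ∈ J, |h k t| ≤ ((a - b) / a) ^ k * erfcHeat (k * b) t * M := by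
  have ha : 0 < a := hb.trans hab
  induction k with
  | zero => simpa [erfcHeat_zero] using hM
  | succ k ih =>
    intro τ hτ
    have hM0 : 0 ≤ M := (abs_nonneg _).trans (hM τ hτ)
    have hρ : 0 ≤ (a - b) / a := div_nonneg (by linarith) ha.le
    have hc : 0 ≤ ((a - b) / a) ^ (k + 1) * M := by positivity
    set c := ((a - b) / a) ^ (k + 1) * M
    set y : ℝ := (k + 1 : ℕ) * b with hy
    -- Each half of the barrier is a solution; their sum is even in `x`, and at `x = b` the first
    -- half is the previous bound.
    have hreg₁ : ∀ x t : ℝ, 0 < t → IsRegularAt (fun x t => erfcHeat (y - x) t) x t :=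
      fun x t ht => (isRegularAt_erfcHeat _ ht).comp_const_sub
    have hreg₂ : ∀ x t : ℝ, 0 < t → IsRegularAt (fun x t => erfcHeat (y + x) t) x t :=
      fun x t ht => (isRegularAt_erfcHeat _ ht).comp_const_add
    have := hit.abs_step_le (m := fun t => ((a - b) / a) ^ k * erfcHeat (k * b) t * M)
      (W := fun x t => c * (erfcHeat (y - x) t + erfcHeat (y + x) t)) hb hab hJ hτ k
      (fun t _ => by have := erfcHeat_pos (k * b) t; positivity)
      (fun t ht => ((hasDerivAt_erfcHeat_time _ ht.1).differentiableAt.const_mul _).mul_const _)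
      (fun t ht => by
        rw [(((hasDerivAt_erfcHeat_time (k * b) ht.1).const_mul _).mul_const M).deriv]
        have := passageDensity_nonneg (ξ := k * b) (by positivity) ht.1.le
        positivity) ih
      (fun p hp => by
        have h₁ := (continuousAt_erfcHeat (p := (y - p.1, p.2)) hp.2.1).comp
          (f := fun p : ℝ × ℝ => (y - p.1, p.2)) (by fun_prop)
        have h₂ := (continuousAt_erfcHeat (p := (y + p.1, p.2)) hp.2.1).comp
          (f := fun p : ℝ × ℝ => (y + p.1, p.2)) (by fun_prop)
        exact (continuousAt_const.mul (h₁.add h₂)).continuousWithinAt)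
      (fun x _ t _ => mul_nonneg hc (add_pos (erfcHeat_pos _ _) (erfcHeat_pos _ _)).le)
      (fun x _ t ht => ((hreg₁ x t ht.1).add (hreg₂ x t ht.1)).const_mul c)
      (fun x _ t ht => by
        rw [heatOp_const_mul ((hreg₁ x t ht.1).add (hreg₂ x t ht.1)),
          heatOp_add (hreg₁ x t ht.1) (hreg₂ x t ht.1), heatOp_comp_const_sub,
          heatOp_comp_const_add, heatOp_erfcHeat _ ht.1, heatOp_erfcHeat _ ht.1]
        simp)
      (fun t ht => by
        have h₁ := (hasDerivAt_erfcHeat_space (y - 0) ht.1).comp_const_sub y 0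
        have h₂ := (hasDerivAt_erfcHeat_space (y + 0) ht.1).comp_const_add y 0
        refine ((h₁.add h₂).const_mul c).congr_deriv ?_
        simp)
      (fun t _ => by
        have h₁ : y - b = k * b := by rw [hy]; push_cast; ring
        rw [h₁, mul_add]
        have h₂ : 0 ≤ c * erfcHeat (y + b) t := mul_nonneg hc (erfcHeat_pos _ _).le
        have h₃ : (a - b) / a * (((a - b) / a) ^ k * erfcHeat (k * b) t * M) =
          c * erfcHeat (k * b) t := by simp only [c, pow_succ]; ring
        linarith)
    refine this.trans_eq ?_
    rw [sub_zero, add_zero]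
    ring

/-! ### From pointwise bounds to norms -/

theorem supNorm_le_mul {J : Set ℝ} {f g : ℝ → ℝ} {C : ℝ} (hC : 0 < C)
    (hfg : supNorm J f ≠ ∞ → ∀ᵐ t ∂volume.restrict J, |g t| ≤ C * (supNorm J f).toReal) :
    supNorm J g ≤ ENNReal.ofReal C * supNorm J f := by
  rcases eq_or_ne (supNorm J f) ∞ with h | h
  · rw [h, ENNReal.mul_top (by simpa using hC)]
    exact le_top
  · rw [supNorm, eLpNorm_exponent_top]
    refine (eLpNormEssSup_le_of_ae_bound (hfg h)).trans_eq ?_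
    rw [ENNReal.ofReal_mul hC.le, ENNReal.ofReal_toReal h]

theorem ae_abs_le_supNorm {J : Set ℝ} {f : ℝ → ℝ} (hf : supNorm J f ≠ ∞) :
    ∀ᵐ t ∂volume.restrict J, |f t| ≤ (supNorm J f).toReal := by
  have h : ∀ᵐ t ∂volume.restrict J, ‖f t‖ₑ ≤ supNorm J f := by
    rw [supNorm, eLpNorm_exponent_top]
    exact ae_le_eLpNormEssSup
  filter_upwards [h] with t ht
  rw [← Real.norm_eq_abs, ← toReal_enorm]
  exact ENNReal.toReal_mono hf ht

theorem abs_le_supNorm_of_continuousOn {J : Set ℝ} {f : ℝ → ℝ} (hJ : IsOpen J)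
    (hc : ContinuousOn f J) (hf : supNorm J f ≠ ∞) : ∀ t ∈ J, |f t| ≤ (supNorm J f).toReal := by
  intro t₀ ht₀
  by_contra! hlt
  have hopen : IsOpen (J ∩ (fun t => |f t|) ⁻¹' Ioi (supNorm J f).toReal) :=
    hc.abs.isOpen_inter_preimage hJ isOpen_Ioi
  have hnull := (ae_restrict_iff' hJ.measurableSet).mp (ae_abs_le_supNorm hf)
  refine (hopen.measure_pos volume ⟨t₀, ht₀, hlt⟩).ne' (measure_mono_null ?_ hnull)
  intro t ht hle
  exact (hle ht.1).not_gt ht.2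

theorem IsClassicalIteration.continuousOn_zero {a b θ : ℝ} {J : Set ℝ} {h : ℕ → ℝ → ℝ}
    {u₁ u₂ : ℕ → ℝ → ℝ → ℝ} (ha : 0 ≤ a) (hJ : IsTimeWindow J)
    (hit : IsClassicalIteration a b θ J h u₁ u₂) : ContinuousOn (h 0) J := by
  have hc : ContinuousOn (fun t => u₁ 1 0 t) J :=
    (hit.heat₁ 0).continuousOn.comp (f := fun t : ℝ => ((0 : ℝ), t)) (by fun_prop) fun t ht =>
      ⟨⟨⟨neg_nonpos.mpr ha, le_rfl⟩, mem_insert_of_mem _ ht⟩,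
        fun h => (hJ t ht).1.ne' (congrArg Prod.snd h)⟩
  exact hc.congr fun t ht => (hit.dirichlet 0 t ht).symm

theorem IsClassicalIteration.supNorm_le_linear {a b : ℝ} {J : Set ℝ} {h : ℕ → ℝ → ℝ}
    {u₁ u₂ : ℕ → ℝ → ℝ → ℝ} (hb : 0 < b) (hab : b < a) (hJ : IsTimeWindow J) (hJo : IsOpen J)
    (hit : IsClassicalIteration a b (1 / 2) J h u₁ u₂) (k : ℕ) :
    supNorm J (h k) ≤ ENNReal.ofReal (((a - b) / (2 * a)) ^ k) * supNorm J (h 0) := by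
  have ha : 0 < a := hb.trans hab
  refine supNorm_le_mul (pow_pos (div_pos (sub_pos.mpr hab) (by positivity)) k) fun hM => ?_
  exact ae_restrict_of_forall_mem hJo.measurableSet (hit.abs_le_linear hb hab hJ
    (abs_le_supNorm_of_continuousOn hJo (hit.continuousOn_zero ha.le hJ) hM) k)

theorem IsClassicalIteration.supNorm_le_superlinear {a b T : ℝ} {h : ℕ → ℝ → ℝ}
    {u₁ u₂ : ℕ → ℝ → ℝ → ℝ} (hb : 0 < b) (hab : b < a)
    (hit : IsClassicalIteration a b (1 / 2) (Ioo 0 T) h u₁ u₂) (k : ℕ) :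
    supNorm (Ioo 0 T) (h k) ≤ ENNReal.ofReal (((a - b) / a) ^ k * erfcHeat (k * b) T) *
      supNorm (Ioo 0 T) (h 0) := by
  have ha : 0 < a := hb.trans hab
  have hρ : 0 < (a - b) / a := div_pos (sub_pos.mpr hab) ha
  have hJ := isTimeWindow_Ioo T
  refine supNorm_le_mul (mul_pos (pow_pos hρ k) (erfcHeat_pos _ _)) fun hM => ?_
  refine ae_restrict_of_forall_mem measurableSet_Ioo fun t ht => ?_
  refine (hit.abs_le_superlinear hb hab hJ (abs_le_supNorm_of_continuousOn isOpen_Ioo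
    (hit.continuousOn_zero ha.le hJ) hM) k t ht).trans ?_
  have := erfcHeat_mono (ξ := k * b) (by positivity) ht.1 ht.2.le
  gcongr

/-! ### Positivity of the odd theta kernel -/

/-- The sine series of the periodic heat kernel's space derivative: up to a constant
factor, the solution of `∂ₜ v = ∂ₓₓ v` on the circle of length `1` that starts from the derivative
of a Dirac mass. -/
noncomputable def sineSeries (x t : ℝ) : ℝ :=
  ∑' n : ℕ, 2 * n * Real.sin (2 * Real.pi * x * n) *
    Real.exp (-Real.pi * n ^ 2 * (4 * Real.pi * t))

theorem summable_pow_mul_exp_sq (k : ℕ) {t : ℝ} (ht : 0 < t) :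
    Summable fun n : ℕ => (n : ℝ) ^ k * Real.exp (-Real.pi * n ^ 2 * (4 * Real.pi * t)) := by
  have := HurwitzKernelBounds.summable_f_nat k 0 (t := 4 * Real.pi * t) (by positivity)
  refine this.congr fun n => ?_
  simp [HurwitzKernelBounds.f_nat]

theorem sineSeries_eq_sinKernel (x : ℝ) {t : ℝ} (ht : 0 < t) :
    sineSeries x t = HurwitzZeta.sinKernel x (4 * Real.pi * t) :=
  (HurwitzZeta.hasSum_nat_sinKernel x (by positivity)).tsum_eq

theorem norm_sineSeries_term_le (n : ℕ) (x : ℝ) {s t : ℝ} (hst : s ≤ t) :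
    ‖2 * n * Real.sin (2 * Real.pi * x * n) * Real.exp (-Real.pi * n ^ 2 * (4 * Real.pi * t))‖ ≤
      2 * ((n : ℝ) ^ 1 * Real.exp (-Real.pi * n ^ 2 * (4 * Real.pi * s))) := by
  rw [norm_mul, norm_mul, Real.norm_eq_abs, Real.norm_eq_abs, Real.norm_eq_abs, Real.abs_exp,
    abs_of_nonneg (by positivity : (0 : ℝ) ≤ 2 * n), pow_one, ← mul_assoc 2 (n : ℝ)]
  gcongr ?_ * Real.exp ?_
  · exact mul_le_of_le_one_right (by positivity) (Real.abs_sin_le_one _)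
  · have : 0 ≤ Real.pi * (n : ℝ) ^ 2 * (4 * Real.pi) := by positivity
    nlinarith

theorem continuousOn_sineSeries :
    ContinuousOn (fun p : ℝ × ℝ => sineSeries p.1 p.2) {p | 0 < p.2} := by
  intro p hp
  have hmem : {q : ℝ × ℝ | p.2 / 2 < q.2} ∈ 𝓝 p :=
    (isOpen_lt continuous_const continuous_snd).mem_nhds
      (show p.2 / 2 < p.2 from half_lt_self hp)
  refine (ContinuousOn.continuousAt ?_ hmem).continuousWithinAt
  refine continuousOn_tsum (fun n => by fun_prop)
    ((summable_pow_mul_exp_sq 1 (half_pos hp)).mul_left 2) fun n q hq => ?_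
  exact norm_sineSeries_term_le n q.1 (le_of_lt hq)

theorem summable_sineSeries_term (x : ℝ) {t : ℝ} (ht : 0 < t) :
    Summable fun n : ℕ => 2 * (n : ℝ) * Real.sin (2 * Real.pi * x * n) *
      Real.exp (-Real.pi * n ^ 2 * (4 * Real.pi * t)) :=
  (HurwitzZeta.hasSum_nat_sinKernel x (by positivity)).summable

theorem hasDerivAt_sineSeries_time (x : ℝ) {t : ℝ} (ht : 0 < t) :
    HasDerivAt (fun t => sineSeries x t)
      (∑' n : ℕ, -(8 * Real.pi ^ 2) * ((n : ℝ) ^ 3 * Real.sin (2 * Real.pi * x * n) *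
        Real.exp (-Real.pi * n ^ 2 * (4 * Real.pi * t)))) t := by
  unfold sineSeries
  refine hasDerivAt_tsum_of_isPreconnected (t := Ioi (t / 2)) (y₀ := t)
    (g := fun (n : ℕ) t => 2 * n * Real.sin (2 * Real.pi * x * n) *
      Real.exp (-Real.pi * n ^ 2 * (4 * Real.pi * t)))
    (g' := fun (n : ℕ) t => -(8 * Real.pi ^ 2) * ((n : ℝ) ^ 3 * Real.sin (2 * Real.pi * x * n) *
      Real.exp (-Real.pi * n ^ 2 * (4 * Real.pi * t))))
    ((summable_pow_mul_exp_sq 3 (half_pos ht)).mul_left (8 * Real.pi ^ 2)) isOpen_Ioi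
    isPreconnected_Ioi (fun n s _ => ?_) (fun n s hs => ?_) (half_lt_self ht)
    ?_ (half_lt_self ht)
  · have := ((((hasDerivAt_id' s).const_mul (4 * Real.pi)).const_mul
      (-Real.pi * (n : ℝ) ^ 2)).exp).const_mul (2 * (n : ℝ) * Real.sin (2 * Real.pi * x * n))
    refine this.congr_deriv ?_
    ring
  · have hs' : t / 2 ≤ s := le_of_lt hs
    rw [norm_mul, norm_mul, norm_mul, Real.norm_eq_abs, Real.norm_eq_abs, Real.norm_eq_abs,
      Real.norm_eq_abs, Real.abs_exp, abs_neg, abs_of_nonneg (by positivity : 0 ≤ 8 * Real.pi ^ 2),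
      abs_of_nonneg (by positivity : (0 : ℝ) ≤ n ^ 3)]
    gcongr ?_ * (?_ * Real.exp ?_)
    · exact mul_le_of_le_one_right (by positivity) (Real.abs_sin_le_one _)
    · have : 0 ≤ Real.pi * (n : ℝ) ^ 2 * (4 * Real.pi) := by positivity
      nlinarith
  · exact summable_sineSeries_term x ht

theorem hasDerivAt_sineSeries_space (x : ℝ) {t : ℝ} (ht : 0 < t) :
    HasDerivAt (fun x => sineSeries x t)
      (∑' n : ℕ, 4 * Real.pi * ((n : ℝ) ^ 2 * Real.cos (2 * Real.pi * x * n) *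
        Real.exp (-Real.pi * n ^ 2 * (4 * Real.pi * t)))) x := by
  unfold sineSeries
  refine hasDerivAt_tsum (y₀ := 0)
    (g := fun (n : ℕ) x => 2 * n * Real.sin (2 * Real.pi * x * n) *
      Real.exp (-Real.pi * n ^ 2 * (4 * Real.pi * t)))
    (g' := fun (n : ℕ) x => 4 * Real.pi * ((n : ℝ) ^ 2 * Real.cos (2 * Real.pi * x * n) *
      Real.exp (-Real.pi * n ^ 2 * (4 * Real.pi * t))))
    ((summable_pow_mul_exp_sq 2 ht).mul_left (4 * Real.pi)) (fun n x => ?_) (fun n x => ?_)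
    ?_ x
  · have := (((((hasDerivAt_id' x).const_mul (2 * Real.pi)).mul_const (n : ℝ)).sin).const_mul
      (2 * (n : ℝ))).mul_const (Real.exp (-Real.pi * n ^ 2 * (4 * Real.pi * t)))
    refine this.congr_deriv ?_
    ring
  · rw [Real.norm_eq_abs, abs_mul (4 * Real.pi),
      abs_of_nonneg (by positivity : 0 ≤ 4 * Real.pi), abs_mul, abs_mul, Real.abs_exp,
      abs_of_nonneg (by positivity : (0 : ℝ) ≤ n ^ 2)]
    gcongr
    exact mul_le_of_le_one_right (by positivity) (Real.abs_cos_le_one _)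
  · exact summable_sineSeries_term 0 ht

theorem norm_sineSeries_space_deriv_term_le (n : ℕ) (x t : ℝ) :
    ‖-(8 * Real.pi ^ 2) * ((n : ℝ) ^ 3 * Real.sin (2 * Real.pi * x * n) *
      Real.exp (-Real.pi * n ^ 2 * (4 * Real.pi * t)))‖ ≤
    8 * Real.pi ^ 2 * ((n : ℝ) ^ 3 * Real.exp (-Real.pi * n ^ 2 * (4 * Real.pi * t))) := by
  rw [norm_mul, norm_mul, norm_mul, Real.norm_eq_abs, Real.norm_eq_abs, Real.norm_eq_abs,
    Real.norm_eq_abs, Real.abs_exp, abs_neg, abs_of_nonneg (by positivity : 0 ≤ 8 * Real.pi ^ 2),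
    abs_of_nonneg (by positivity : (0 : ℝ) ≤ n ^ 3)]
  gcongr
  exact mul_le_of_le_one_right (by positivity) (Real.abs_sin_le_one _)

theorem hasDerivAt_sineSeries_space_deriv (x : ℝ) {t : ℝ} (ht : 0 < t) :
    HasDerivAt (fun x => ∑' n : ℕ, 4 * Real.pi * ((n : ℝ) ^ 2 * Real.cos (2 * Real.pi * x * n) *
        Real.exp (-Real.pi * n ^ 2 * (4 * Real.pi * t))))
      (∑' n : ℕ, -(8 * Real.pi ^ 2) * ((n : ℝ) ^ 3 * Real.sin (2 * Real.pi * x * n) *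
        Real.exp (-Real.pi * n ^ 2 * (4 * Real.pi * t)))) x := by
  refine hasDerivAt_tsum (y₀ := 0)
    ((summable_pow_mul_exp_sq 3 ht).mul_left (8 * Real.pi ^ 2)) (fun n x => ?_)
    (fun n x => norm_sineSeries_space_deriv_term_le n x t) ?_ x
  · have := ((((((hasDerivAt_id' x).const_mul (2 * Real.pi)).mul_const (n : ℝ)).cos).const_mul
      ((n : ℝ) ^ 2)).mul_const (Real.exp (-Real.pi * n ^ 2 * (4 * Real.pi * t)))).const_mul
      (4 * Real.pi)
    refine this.congr_deriv ?_
    ring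
  · simpa using (summable_pow_mul_exp_sq 2 ht).mul_left (4 * Real.pi)

theorem isRegularAt_sineSeries (x : ℝ) {t : ℝ} (ht : 0 < t) : IsRegularAt sineSeries x t := by
  refine ⟨(hasDerivAt_sineSeries_time x ht).differentiableAt, ContDiff.contDiffAt ?_⟩
  rw [show (2 : WithTop ℕ∞) = 1 + 1 by norm_num, contDiff_succ_iff_deriv]
  refine ⟨fun x => (hasDerivAt_sineSeries_space x ht).differentiableAt, by simp, ?_⟩
  rw [funext fun x => (hasDerivAt_sineSeries_space x ht).deriv, contDiff_one_iff_deriv]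
  refine ⟨fun x => (hasDerivAt_sineSeries_space_deriv x ht).differentiableAt, ?_⟩
  rw [funext fun x => (hasDerivAt_sineSeries_space_deriv x ht).deriv]
  exact continuous_tsum (fun n => by fun_prop)
    ((summable_pow_mul_exp_sq 3 ht).mul_left (8 * Real.pi ^ 2))
    fun n x => norm_sineSeries_space_deriv_term_le n x t

theorem heatOp_sineSeries (x : ℝ) {t : ℝ} (ht : 0 < t) : heatOp sineSeries x t = 0 := by
  rw [heatOp, iteratedDeriv_succ, iteratedDeriv_one,
    funext fun x => (hasDerivAt_sineSeries_space x ht).deriv,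
    (hasDerivAt_sineSeries_space_deriv x ht).deriv, (hasDerivAt_sineSeries_time x ht).deriv,
    sub_self]

/-- In the image series for the odd kernel only the images on the negative side are negative, and
these are at distance at least `1 / 2`. -/
theorem exists_neg_le_oddKernel : ∃ C : ℝ, ∀ x ∈ Icc (0 : ℝ) (1 / 2), ∀ X : ℝ, 1 ≤ X →
    -(C * Real.exp (-(Real.pi / 8) * X)) ≤ HurwitzZeta.oddKernel x X := by
  have hsum : Summable fun n : ℤ => |(n : ℝ)| * Real.exp (-Real.pi * n ^ 2 * (1 / 8)) := by
    have := HurwitzKernelBounds.summable_f_int 1 0 (t := 1 / 8) (by norm_num)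
    refine this.congr fun n => ?_
    simp [HurwitzKernelBounds.f_int]
  refine ⟨∑' n : ℤ, |(n : ℝ)| * Real.exp (-Real.pi * n ^ 2 * (1 / 8)), fun x hx X hX => ?_⟩
  refine hasSum_le (fun n => ?_) (hsum.hasSum.mul_right _).neg
    (HurwitzZeta.hasSum_int_oddKernel x (by linarith))
  rcases le_or_gt 0 n with hn | hn
  · have h₁ : (0 : ℝ) ≤ n := by exact_mod_cast hn
    have h₂ : 0 ≤ (n + x) * Real.exp (-Real.pi * (n + x) ^ 2 * X) :=
      mul_nonneg (add_nonneg h₁ hx.1) (Real.exp_pos _).le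
    refine le_trans (neg_nonpos.mpr (by positivity)) h₂
  · have h₁ : (n : ℝ) ≤ -1 := by exact_mod_cast Int.le_sub_one_of_lt hn
    rw [abs_of_neg (by linarith), mul_assoc, ← Real.exp_add, neg_mul, neg_neg]
    have h₂ : Real.exp (-Real.pi * (n + x) ^ 2 * X) ≤
        Real.exp (-Real.pi * n ^ 2 * (1 / 8) + -(Real.pi / 8) * X) := by
      have hsq : (n : ℝ) ^ 2 / 4 ≤ (n + x) ^ 2 := by nlinarith [hx.1, hx.2]
      have h1n : 1 ≤ (n : ℝ) ^ 2 := by nlinarith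
      have hX' : (n : ℝ) ^ 2 / 8 + X / 8 ≤ (n + x) ^ 2 * X := by nlinarith
      rw [Real.exp_le_exp]
      nlinarith [Real.pi_pos]
    calc (n : ℝ) * Real.exp (-Real.pi * n ^ 2 * (1 / 8) + -(Real.pi / 8) * X)
        ≤ n * Real.exp (-Real.pi * (n + x) ^ 2 * X) :=
          mul_le_mul_of_nonpos_left h₂ (by linarith)
      _ ≤ (n + x) * Real.exp (-Real.pi * (n + x) ^ 2 * X) := by
          gcongr; linarith [hx.1]

/-- The heat kernel on the circle decreases with the distance, in the form of a sign of its
derivative. The sine series solves the heat equation and vanishes at the end points of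
`[0, 1 / 2]`; the image series shows that its lower limit as `t → 0` is nonnegative. -/
theorem sineSeries_nonneg {x t : ℝ} (hx : x ∈ Icc (0 : ℝ) (1 / 2)) (ht : 0 < t) :
    0 ≤ sineSeries x t := by
  obtain ⟨C, hC⟩ := exists_neg_le_oddKernel
  have hmp := maximum_principle (v := fun x s => (-1) * sineSeries x s) (l := 0) (r := 1 / 2)
    (τ := t) ?_ ?_ ?_ ?_ ?_ ?_ x hx t ⟨ht, le_rfl⟩
  · linarith
  · exact continuousOn_const.mul (continuousOn_sineSeries.mono fun p hp => hp.2.1)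
  · intro x _ ε hε
    have hX : Tendsto (fun p : ℝ × ℝ => 1 / (4 * Real.pi * p.2))
        (𝓝[Icc 0 (1 / 2) ×ˢ Ioc 0 t] (x, 0)) atTop := by
      simp only [one_div]
      refine tendsto_inv_nhdsGT_zero.comp (tendsto_nhdsWithin_iff.mpr ⟨?_, ?_⟩)
      · have : Continuous fun p : ℝ × ℝ => 4 * Real.pi * p.2 := by fun_prop
        exact ((this.tendsto (x, 0)).mono_left nhdsWithin_le_nhds).trans_eq (by simp)
      · filter_upwards [self_mem_nhdsWithin] with p hp
        have := hp.2.1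
        exact mem_Ioi.mpr (by positivity)
    have hlim := ((tendsto_rpow_mul_exp_neg_mul_atTop_nhds_zero (3 / 2) (Real.pi / 8)
      (by positivity)).const_mul C).comp hX
    rw [mul_zero] at hlim
    filter_upwards [hlim.eventually (gt_mem_nhds hε), hX.eventually_ge_atTop 1,
      self_mem_nhdsWithin] with p hp hp1 hpQ
    have hp0 : 0 < 4 * Real.pi * p.2 := mul_pos (by positivity) hpQ.2.1
    set X := 1 / (4 * Real.pi * p.2) with hXdef
    have hX0 : 0 < X := by positivity
    have hfe := HurwitzZeta.oddKernel_functional_equation p.1 X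
    rw [hXdef, one_div_one_div, ← hXdef, ← sineSeries_eq_sinKernel _ hpQ.2.1] at hfe
    have hXp : 0 < X ^ (3 / 2 : ℝ) := Real.rpow_pos_of_pos hX0 _
    have hs : sineSeries p.1 p.2 = X ^ (3 / 2 : ℝ) * HurwitzZeta.oddKernel p.1 X := by
      rw [hfe]; field_simp
    have := mul_le_mul_of_nonneg_left (hC p.1 hpQ.1 X hp1) hXp.le
    simp only [Function.comp_apply] at hp
    rw [hs]
    linarith
  · intro t _
    left
    simp [sineSeries]
  · intro t _
    have : ∀ n : ℕ, Real.sin (2 * Real.pi * (1 / 2) * n) = 0 := fun n => by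
      rw [show 2 * Real.pi * (1 / 2) * n = n * Real.pi by ring, Real.sin_nat_mul_pi]
    simp only [sineSeries, this]
    simp
  · intro x _ t ht
    exact (isRegularAt_sineSeries x ht.1).const_mul (-1)
  · intro x _ t ht
    rw [heatOp_const_mul (isRegularAt_sineSeries x ht.1), heatOp_sineSeries x ht.1]
    simp

theorem oddKernel_nonneg {x X : ℝ} (hx : x ∈ Icc (0 : ℝ) (1 / 2)) (hX : 0 < X) :
    0 ≤ HurwitzZeta.oddKernel x X := by
  have h := sineSeries_nonneg hx (t := 1 / (4 * Real.pi * X)) (by positivity)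
  rw [sineSeries_eq_sinKernel x (by positivity),
    show 4 * Real.pi * (1 / (4 * Real.pi * X)) = 1 / X by field_simp] at h
  rw [HurwitzZeta.oddKernel_functional_equation]
  have : 0 < X ^ (3 / 2 : ℝ) := Real.rpow_pos_of_pos hX _
  positivity

/-! ### The Laplace transform: convolutions and injectivity -/

theorem norm_cexp_neg_mul (s : ℂ) (t : ℝ) : ‖Complex.exp (-s * t)‖ = Real.exp (-s.re * t) := by
  rw [Complex.norm_exp]; simp

section

variable {c : ℝ} {f g : ℝ → ℝ} {s : ℂ}

theorem HasLaplace.integrableOn_cexp (hf : HasLaplace c f) (hs : c < s.re) :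
    IntegrableOn (fun t : ℝ => Complex.exp (-s * t) * (f t : ℂ)) (Ioi 0) := by
  have h : IntegrableOn (fun t : ℝ => Complex.exp (-(s.im * t) * Complex.I) *
      ((Real.exp (-s.re * t) * f t : ℝ) : ℂ)) (Ioi 0) := by
    refine (hf s.re hs).ofReal.bdd_mul (c := 1) (by fun_prop) (ae_of_all _ fun t => ?_)
    rw [← Complex.ofReal_mul, ← Complex.ofReal_neg, Complex.norm_exp_ofReal_mul_I]
  refine h.congr_fun (fun t _ => ?_) measurableSet_Ioi
  have : -s * t = -(s.im * t) * Complex.I + ((-s.re * t : ℝ) : ℂ) := by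
    conv_lhs => rw [← Complex.re_add_im s]
    push_cast; ring
  simp only
  rw [this, Complex.exp_add]
  push_cast; ring

theorem HasLaplace.mono {c' : ℝ} (hf : HasLaplace c f) (hc : c ≤ c') : HasLaplace c' f :=
  fun σ hσ => hf σ (hc.trans_lt hσ)

theorem HasLaplace.add (hf : HasLaplace c f) (hg : HasLaplace c g) :
    HasLaplace c fun t => f t + g t := fun σ hσ => by
  have h : IntegrableOn (fun t => Real.exp (-σ * t) * f t + Real.exp (-σ * t) * g t) (Ioi 0) :=
    (hf σ hσ).add (hg σ hσ)
  simpa only [mul_add] using h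

theorem laplace_add (hf : HasLaplace c f) (hg : HasLaplace c g) (hs : c < s.re) :
    laplace (fun t => f t + g t) s = laplace f s + laplace g s := by
  rw [laplace, laplace, laplace, ← integral_add (hf.integrableOn_cexp hs) (hg.integrableOn_cexp hs)]
  simp only [Complex.ofReal_add, mul_add]

theorem HasLaplace.congr (hf : HasLaplace c f) (hfg : EqOn f g (Ioi 0)) : HasLaplace c g :=
  fun σ hσ => (hf σ hσ).congr_fun (fun t ht => by simp only [hfg ht]) measurableSet_Ioi

theorem laplace_congr (hfg : EqOn f g (Ioi 0)) : laplace f s = laplace g s :=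
  setIntegral_congr_fun measurableSet_Ioi fun t ht => by simp only [hfg ht]

theorem laplace_ofReal (f : ℝ → ℝ) (σ : ℝ) :
    laplace f σ = ((∫ t in Ioi (0 : ℝ), Real.exp (-σ * t) * f t : ℝ) : ℂ) := by
  rw [laplace, ← integral_complex_ofReal]
  simp

theorem HasLaplace.integrableOn_Ioc (hf : HasLaplace c f) (t : ℝ) : IntegrableOn f (Ioc 0 t) := by
  have h := (hf (c + 1) (lt_add_one c)).mono_set ((Ioc_subset_Ioi_self : Ioc 0 t ⊆ Ioi 0))
  have h' : IntegrableOn (fun u => Real.exp ((c + 1) * u) * (Real.exp (-(c + 1) * u) * f u))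
      (Ioc 0 t) := by
    refine h.bdd_mul (c := Real.exp (|c + 1| * |t|)) (by fun_prop) ?_
    filter_upwards [ae_restrict_mem measurableSet_Ioc] with u hu
    rw [Real.norm_eq_abs, Real.abs_exp, Real.exp_le_exp]
    calc (c + 1) * u ≤ |(c + 1) * u| := le_abs_self _
      _ = |c + 1| * |u| := abs_mul _ _
      _ ≤ |c + 1| * |t| := by
        gcongr
        exacts [hu.1.le, hu.2]
  refine h'.congr_fun (fun u _ => ?_) measurableSet_Ioc
  simp only
  rw [← mul_assoc, ← Real.exp_add, ← add_mul, add_neg_cancel, zero_mul, Real.exp_zero, one_mul]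

/-- A nonnegative function whose Laplace transform is at most `A` on the positive real axis has
integral at most `A`. -/
theorem HasLaplace.integral_le {A : ℝ} (hf : HasLaplace 0 f) (hf0 : ∀ t > 0, 0 ≤ f t)
    (hA : ∀ σ : ℝ, 0 < σ → ∫ t in Ioi (0 : ℝ), Real.exp (-σ * t) * f t ≤ A) (t : ℝ) :
    ∫ u in Ioc 0 t, f u ≤ A := by
  rcases le_or_gt t 0 with ht | ht
  · rw [Ioc_eq_empty (not_lt.mpr ht), setIntegral_empty]
    exact (setIntegral_nonneg measurableSet_Ioi fun u hu =>
      mul_nonneg (Real.exp_pos _).le (hf0 u hu)).trans (hA 1 one_pos)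
  have key : ∀ σ > 0, ∫ u in Ioc 0 t, f u ≤ Real.exp (σ * t) * A := by
    intro σ hσ
    have hint : IntegrableOn (fun u => Real.exp (-σ * u) * f u) (Ioc 0 t) :=
      (hf σ hσ).mono_set Ioc_subset_Ioi_self
    calc ∫ u in Ioc 0 t, f u
        ≤ ∫ u in Ioc 0 t, Real.exp (σ * t) * (Real.exp (-σ * u) * f u) := by
          refine setIntegral_mono_on (hf.integrableOn_Ioc t) (hint.const_mul _) measurableSet_Ioc
            fun u hu => ?_
          rw [← mul_assoc, ← Real.exp_add]
          refine le_mul_of_one_le_left (hf0 u hu.1) (Real.one_le_exp ?_)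
          nlinarith [hu.2]
      _ = Real.exp (σ * t) * ∫ u in Ioc 0 t, Real.exp (-σ * u) * f u := integral_const_mul _ _
      _ ≤ Real.exp (σ * t) * ∫ u in Ioi 0, Real.exp (-σ * u) * f u := by
          refine mul_le_mul_of_nonneg_left ?_ (Real.exp_pos _).le
          refine setIntegral_mono_set (hf σ hσ) ?_ Ioc_subset_Ioi_self.eventuallyLE
          filter_upwards [ae_restrict_mem measurableSet_Ioi] with u hu
          exact mul_nonneg (Real.exp_pos _).le (hf0 u hu)
      _ ≤ Real.exp (σ * t) * A := by gcongr; exact hA σ hσ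
  have hlim : Tendsto (fun σ => Real.exp (σ * t) * A) (𝓝[>] 0) (𝓝 (Real.exp (0 * t) * A)) :=
    ((by fun_prop : Continuous fun σ => Real.exp (σ * t) * A).tendsto 0).mono_left
      nhdsWithin_le_nhds
  have := ge_of_tendsto hlim (by filter_upwards [self_mem_nhdsWithin] with σ hσ using key σ hσ)
  simpa using this

/-- The convolution of functions on the positive half-line. -/
noncomputable def conv (f g : ℝ → ℝ) (t : ℝ) : ℝ := ∫ u in Ioc 0 t, f u * g (t - u)

theorem HasLaplace.conv (hf : HasLaplace c f) (hg : HasLaplace c g) :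
    HasLaplace c (conv f g) := by
  intro σ hσ
  have h := (integrable_posConvolution (hf σ hσ) (hg σ hσ)
    (ContinuousLinearMap.mul ℝ ℝ)).integrableOn (s := Ioi 0)
  refine h.congr_fun (fun t ht => ?_) measurableSet_Ioi
  simp only [posConvolution, indicator_of_mem ht, ContinuousLinearMap.mul_apply']
  rw [intervalIntegral.integral_of_le (le_of_lt ht), DNWR.conv, ← integral_const_mul]
  refine setIntegral_congr_fun measurableSet_Ioc fun u _ => ?_
  rw [show -σ * t = -σ * u + -σ * (t - u) by ring, Real.exp_add]
  ring

theorem laplace_conv (hf : HasLaplace c f) (hg : HasLaplace c g) (hs : c < s.re) :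
    laplace (conv f g) s = laplace f s * laplace g s := by
  have h := integral_posConvolution (hf.integrableOn_cexp hs) (hg.integrableOn_cexp hs)
    (ContinuousLinearMap.mul ℝ ℂ)
  simp only [ContinuousLinearMap.mul_apply'] at h
  rw [laplace, laplace, laplace, ← h]
  refine setIntegral_congr_fun measurableSet_Ioi fun t ht => ?_
  rw [intervalIntegral.integral_of_le (le_of_lt ht), conv, ← integral_complex_ofReal,
    ← integral_const_mul]
  refine setIntegral_congr_fun measurableSet_Ioc fun u _ => ?_
  rw [show -s * t = -s * u + -s * ((t - u : ℝ) : ℂ) by push_cast; ring, Complex.exp_add]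
  push_cast; ring

/-- An integrable real function is determined by its Fourier transform: if that vanishes, then the
measures whose densities are its positive and negative parts have the same characteristic
function. -/
theorem ae_eq_zero_of_integral_cexp_eq_zero {μ : Measure ℝ} {F : ℝ → ℝ} (hF : Integrable F μ)
    (h : ∀ ξ : ℝ, ∫ t, Complex.exp (ξ * t * Complex.I) * (F t : ℂ) ∂μ = 0) : F =ᵐ[μ] 0 := by
  have hpos : ∀ G : ℝ → ℝ, Integrable G μ →
      (∫⁻ t, ENNReal.ofReal (G t) ∂μ ≠ ∞ ∧
        ∀ ξ : ℝ, charFun (μ.withDensity fun t => ENNReal.ofReal (G t)) ξ =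
          ∫ t, Complex.exp (ξ * t * Complex.I) * ((max (G t) 0 : ℝ) : ℂ) ∂μ) := by
    intro G hG
    refine ⟨hG.lintegral_lt_top.ne, fun ξ => ?_⟩
    rw [charFun_apply_real, integral_withDensity_eq_integral_toReal_smul₀
      hG.aemeasurable.ennreal_ofReal (ae_of_all _ fun _ => ENNReal.ofReal_lt_top)]
    refine integral_congr_ae (ae_of_all _ fun t => ?_)
    simp only [ENNReal.toReal_ofReal', Complex.real_smul]
    ring
  have hint : ∀ (G : ℝ → ℝ) (ξ : ℝ), Integrable G μ →
      Integrable (fun t : ℝ => Complex.exp (ξ * t * Complex.I) * ((max (G t) 0 : ℝ) : ℂ)) μ := by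
    intro G ξ hG
    refine hG.pos_part.ofReal.bdd_mul (c := 1) (by fun_prop) (ae_of_all _ fun t => ?_)
    rw [← Complex.ofReal_mul, Complex.norm_exp_ofReal_mul_I]
  have hFneg : Integrable (fun t => -F t) μ := hF.neg
  obtain ⟨hfin₁, hchar₁⟩ := hpos F hF
  obtain ⟨hfin₂, hchar₂⟩ := hpos (fun t => -F t) hFneg
  have hfm₁ : IsFiniteMeasure (μ.withDensity fun t => ENNReal.ofReal (F t)) :=
    isFiniteMeasure_withDensity hfin₁
  have hfm₂ : IsFiniteMeasure (μ.withDensity fun t => ENNReal.ofReal (-F t)) :=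
    isFiniteMeasure_withDensity hfin₂
  have heq : (μ.withDensity fun t => ENNReal.ofReal (F t)) =
      μ.withDensity fun t => ENNReal.ofReal (-F t) := by
    refine Measure.ext_of_charFun (funext fun ξ => ?_)
    rw [hchar₁, hchar₂, ← sub_eq_zero, ← integral_sub (hint F ξ hF) (hint _ ξ hFneg), ← h ξ]
    refine integral_congr_ae (ae_of_all _ fun t => ?_)
    simp only
    rw [← mul_sub, ← Complex.ofReal_sub, max_zero_sub_eq_self]
  rw [withDensity_eq_iff hF.aemeasurable.ennreal_ofReal hFneg.aemeasurable.ennreal_ofReal hfin₁]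
    at heq
  filter_upwards [heq] with t ht
  rcases le_total (F t) 0 with h0 | h0
  · rw [ENNReal.ofReal_of_nonpos h0, eq_comm, ENNReal.ofReal_eq_zero] at ht
    simp only [Pi.zero_apply]; linarith
  · rw [ENNReal.ofReal_of_nonpos (neg_nonpos.mpr h0), ENNReal.ofReal_eq_zero] at ht
    simp only [Pi.zero_apply]; linarith

/-- A function is determined up to null sets by its Laplace transform on a half-plane. -/
theorem ae_eq_of_laplace_eq (hf : HasLaplace c f) (hg : HasLaplace c g)
    (h : ∀ s : ℂ, c < s.re → laplace f s = laplace g s) :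
    ∀ᵐ t ∂volume.restrict (Ioi 0), f t = g t := by
  have h0 := ae_eq_zero_of_integral_cexp_eq_zero
    (F := fun t => Real.exp (-(c + 1) * t) * f t - Real.exp (-(c + 1) * t) * g t)
    ((hf (c + 1) (lt_add_one c)).sub (hg (c + 1) (lt_add_one c))) fun ξ => by
      have hs : c < ((c + 1 : ℝ) - ξ * Complex.I : ℂ).re := by simp
      have := h _ hs
      rw [laplace, laplace, ← sub_eq_zero, ← integral_sub (hf.integrableOn_cexp hs)
        (hg.integrableOn_cexp hs)] at this
      rw [← this]
      refine integral_congr_ae (ae_of_all _ fun t => ?_)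
      simp only
      rw [show -((c + 1 : ℝ) - ξ * Complex.I : ℂ) * t =
        ξ * t * Complex.I + ((-(c + 1) * t : ℝ) : ℂ) by push_cast; ring, Complex.exp_add]
      push_cast; ring
  filter_upwards [h0] with t ht
  have := Real.exp_pos (-(c + 1) * t)
  rw [Pi.zero_apply, ← mul_sub, mul_eq_zero] at ht
  exact sub_eq_zero.mp (ht.resolve_left this.ne')

/-! ### Bounds on convolutions -/

/-- A bound that holds for almost all times before `t` holds along the reversed time `t - u`. -/
theorem ae_restrict_Ioc_comp_sub {t : ℝ} {P : ℝ → Prop}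
    (h : ∀ᵐ u ∂volume.restrict (Ioo 0 t), P u) :
    ∀ᵐ u ∂volume.restrict (Ioc 0 t), P (t - u) := by
  rw [← restrict_Ioo_eq_restrict_Ioc, ae_restrict_iff' measurableSet_Ioo]
  rw [ae_restrict_iff' measurableSet_Ioo] at h
  filter_upwards [(Measure.measurePreserving_sub_left volume t).quasiMeasurePreserving.ae h] with u hu hut
  exact hu ⟨by linarith [hut.2], by linarith [hut.1]⟩

theorem abs_conv_le {f g m : ℝ → ℝ} {t : ℝ} (hf : ∀ u > 0, 0 ≤ f u)
    (hgm : ∀ᵐ u ∂volume.restrict (Ioo 0 t), |g u| ≤ m u)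
    (hint : IntegrableOn (fun u => f u * m (t - u)) (Ioc 0 t)) : |conv f g t| ≤ conv f m t := by
  rw [← Real.norm_eq_abs, conv, conv]
  refine norm_integral_le_of_norm_le hint ?_
  filter_upwards [ae_restrict_Ioc_comp_sub hgm, ae_restrict_mem measurableSet_Ioc] with u hu hut
  rw [norm_mul, Real.norm_of_nonneg (hf u hut.1)]
  exact mul_le_mul_of_nonneg_left hu (hf u hut.1)

/-- Convolution of a nonnegative kernel of mass at most `A` with a function that is bounded by a
nondecreasing function `m`. -/
theorem abs_conv_le_mul {f g m : ℝ → ℝ} {A t : ℝ} (hf : ∀ u > 0, 0 ≤ f u)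
    (hfi : IntegrableOn f (Ioc 0 t)) (hA : ∫ u in Ioc 0 t, f u ≤ A) (hm0 : 0 ≤ m t)
    (hm : ∀ u ∈ Ioo 0 t, m u ≤ m t) (hgm : ∀ᵐ u ∂volume.restrict (Ioo 0 t), |g u| ≤ m u) :
    |conv f g t| ≤ A * m t := by
  have hgm' : ∀ᵐ u ∂volume.restrict (Ioo 0 t), |g u| ≤ m t := by
    filter_upwards [hgm, ae_restrict_mem measurableSet_Ioo] with u hu hut using hu.trans (hm u hut)
  refine (abs_conv_le (m := fun _ => m t) hf hgm' (hfi.mul_const _)).trans ?_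
  rw [conv, integral_mul_const]
  exact mul_le_mul_of_nonneg_right hA hm0

end

/-! ### Analyticity of the Laplace transform -/

theorem HasLaplace.differentiableAt_laplace {c : ℝ} {f : ℝ → ℝ} (hf : HasLaplace c f) {s : ℂ}
    (hs : c < s.re) : DifferentiableAt ℂ (laplace f) s := by
  set ε := (s.re - c) / 3 with hε
  have hε0 : 0 < ε := by rw [hε]; linarith
  have hmem : {w : ℂ | s.re - ε < w.re} ∈ 𝓝 s :=
    (isOpen_lt continuous_const Complex.continuous_re).mem_nhds (by simp [hε0])
  have hmeas : ∀ w : ℂ, c < w.re → AEStronglyMeasurable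
      (fun t : ℝ => Complex.exp (-w * t) * (f t : ℂ)) (volume.restrict (Ioi 0)) := fun w hw =>
    (hf.integrableOn_cexp hw).aestronglyMeasurable
  have hderiv := hasDerivAt_integral_of_dominated_loc_of_deriv_le (𝕜 := ℂ)
    (μ := volume.restrict (Ioi (0 : ℝ))) (x₀ := s)
    (F := fun w t => Complex.exp (-w * t) * (f t : ℂ))
    (F' := fun w t => -(t : ℂ) * (Complex.exp (-w * t) * (f t : ℂ)))
    (bound := fun t => ε⁻¹ * ‖Real.exp (-(s.re - 2 * ε) * t) * f t‖) hmem
    (by filter_upwards [hmem] with w hw; exact hmeas w (by have hw' : s.re - ε < w.re := hw; linarith))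
    (hf.integrableOn_cexp hs)
    ((by fun_prop : Continuous fun t : ℝ => -(t : ℂ)).aestronglyMeasurable.mul (hmeas s hs))
    (by
      filter_upwards [ae_restrict_mem measurableSet_Ioi] with t ht w hw
      have ht0 : 0 < t := ht
      have hw' : s.re - ε < w.re := hw
      rw [norm_mul, norm_mul, norm_mul, norm_neg, norm_cexp_neg_mul, Complex.norm_real,
        Complex.norm_real, ← mul_assoc, ← mul_assoc, Real.norm_of_nonneg ht0.le,
        Real.norm_of_nonneg (Real.exp_pos _).le]
      refine mul_le_mul_of_nonneg_right ?_ (norm_nonneg _)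
      have h₁ : ε * t ≤ Real.exp (ε * t) := by linarith [Real.add_one_le_exp (ε * t)]
      have h₂ : Real.exp (-w.re * t) ≤ Real.exp (-(s.re - ε) * t) :=
        Real.exp_le_exp.mpr (by nlinarith)
      calc t * Real.exp (-w.re * t) = ε⁻¹ * (ε * t * Real.exp (-w.re * t)) := by
            field_simp
        _ ≤ ε⁻¹ * (Real.exp (ε * t) * Real.exp (-(s.re - ε) * t)) := by gcongr
        _ = ε⁻¹ * Real.exp (-(s.re - 2 * ε) * t) := by rw [← Real.exp_add]; ring_nf)
    ((hf _ (by linarith)).norm.const_mul _)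
    (by
      refine ae_of_all _ fun t w _ => ?_
      have := (((hasDerivAt_neg w).mul_const (t : ℂ)).cexp).mul_const (f t : ℂ)
      refine this.congr_deriv ?_
      ring)
  exact hderiv.2.differentiableAt

/-- A formula for a Laplace transform that holds on the positive real axis holds on the right
half-plane, if it is holomorphic there. -/
theorem laplace_eq_of_forall_ofReal {f : ℝ → ℝ} {F : ℂ → ℂ} (hf : HasLaplace 0 f)
    (hF : DifferentiableOn ℂ F {s | 0 < s.re}) (h : ∀ σ : ℝ, 0 < σ → laplace f σ = F σ) {s : ℂ}
    (hs : 0 < s.re) : laplace f s = F s := by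
  have hopen : IsOpen {s : ℂ | 0 < s.re} := isOpen_lt continuous_const Complex.continuous_re
  have hL : DifferentiableOn ℂ (laplace f) {s | 0 < s.re} := fun w hw =>
    (hf.differentiableAt_laplace hw).differentiableWithinAt
  have hconn : IsPreconnected {s : ℂ | 0 < s.re} := (convex_halfSpace_re_gt 0).isPreconnected
  refine (hL.analyticOnNhd hopen).eqOn_of_preconnected_of_frequently_eq (hF.analyticOnNhd hopen)
    hconn (z₀ := ((1 : ℝ) : ℂ)) (by simp) ?_ hs
  have htend : Tendsto (fun σ : ℝ => (σ : ℂ)) (𝓝[>] 1) (𝓝[≠] ((1 : ℝ) : ℂ)) := by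
    refine tendsto_nhdsWithin_iff.mpr
      ⟨(Complex.continuous_ofReal.tendsto 1).mono_left nhdsWithin_le_nhds, ?_⟩
    filter_upwards [self_mem_nhdsWithin] with σ hσ
    exact fun h => (ne_of_gt hσ) (Complex.ofReal_injective h)
  refine htend.frequently (Eventually.frequently ?_)
  filter_upwards [self_mem_nhdsWithin] with σ hσ
  exact h σ (one_pos.trans hσ)

/-! ### The square root in the right half-plane -/

/-- The principal square root of a complex number. -/
noncomputable def csqrt (s : ℂ) : ℂ := s ^ (2⁻¹ : ℂ)

theorem csqrt_sq (s : ℂ) : csqrt s ^ 2 = s := Complex.cpow_ofNat_inv_pow s 2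

theorem csqrt_re_pos {s : ℂ} (hs : 0 < s.re) : 0 < (csqrt s).re := by
  have hs0 : s ≠ 0 := by rintro rfl; simp at hs
  have harg : |s.arg| < Real.pi / 2 := Complex.abs_arg_lt_pi_div_two_iff.mpr (Or.inl hs)
  rw [abs_lt] at harg
  rw [csqrt, Complex.cpow_def_of_ne_zero hs0, Complex.exp_re]
  refine mul_pos (Real.exp_pos _) (Real.cos_pos_of_mem_Ioo ?_)
  have : (Complex.log s * 2⁻¹).im = s.arg / 2 := by
    rw [show (2⁻¹ : ℂ) = ((2⁻¹ : ℝ) : ℂ) by push_cast; rfl, Complex.im_mul_ofReal, Complex.log_im]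
    ring
  rw [this]
  constructor <;> linarith [harg.1, harg.2, Real.pi_pos]

theorem csqrt_ofReal {σ : ℝ} (hσ : 0 ≤ σ) : csqrt σ = (√σ : ℝ) := by
  rw [csqrt, Real.sqrt_eq_rpow, Complex.ofReal_cpow hσ]
  norm_num

theorem differentiableAt_csqrt {s : ℂ} (hs : 0 < s.re) : DifferentiableAt ℂ csqrt s :=
  differentiableAt_id.cpow (differentiableAt_const _) (Or.inl hs)

theorem sinh_ne_zero_of_re_pos {z : ℂ} (hz : 0 < z.re) : Complex.sinh z ≠ 0 := by
  intro h
  rw [Complex.sinh, div_eq_zero_iff, sub_eq_zero] at h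
  have := congrArg norm (h.resolve_right two_ne_zero)
  rw [Complex.norm_exp, Complex.norm_exp, Real.exp_eq_exp, Complex.neg_re] at this
  linarith

theorem cosh_ne_zero_of_re_pos {z : ℂ} (hz : 0 < z.re) : Complex.cosh z ≠ 0 := by
  intro h
  rw [Complex.cosh, div_eq_zero_iff, add_eq_zero_iff_eq_neg] at h
  have := congrArg norm (h.resolve_right two_ne_zero)
  rw [norm_neg, Complex.norm_exp, Complex.norm_exp, Real.exp_eq_exp, Complex.neg_re] at this
  linarith

/-! ### The Laplace transform of the first passage density -/

theorem tendsto_div_sqrt_add_atTop {y : ℝ} (hy : 0 < y) (c : ℝ) :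
    Tendsto (fun t => y / (2 * √t) + c * √t) (𝓝[>] 0) atTop := by
  have h₀ : Tendsto (fun t => 2 * √t) (𝓝[>] 0) (𝓝[>] 0) := by
    refine tendsto_nhdsWithin_iff.mpr ⟨?_, ?_⟩
    · exact (((by fun_prop : Continuous fun t => 2 * √t).tendsto 0).mono_left
        nhdsWithin_le_nhds).trans_eq (by simp)
    · filter_upwards [self_mem_nhdsWithin] with t ht
      have : 0 < t := ht
      exact mem_Ioi.mpr (by positivity)
  have h₁ : Tendsto (fun t => y / (2 * √t)) (𝓝[>] 0) atTop := by
    simp only [div_eq_mul_inv]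
    exact (tendsto_inv_nhdsGT_zero.comp h₀).const_mul_atTop hy
  refine h₁.atTop_add (C := c * √0) ?_
  exact ((by fun_prop : Continuous fun t => c * √t).tendsto 0).mono_left nhdsWithin_le_nhds

theorem tendsto_div_sqrt_atTop (y : ℝ) : Tendsto (fun t => y / (2 * √t)) atTop (𝓝 0) :=
  tendsto_const_nhds.div_atTop (Real.tendsto_sqrt_atTop.const_mul_atTop two_pos)

/-- The Laplace transform of the passage density on the real axis. The antiderivative of
`e^{-σt} p_y(t)` is a combination of two error functions. -/
theorem integral_exp_mul_passageDensity {y σ : ℝ} (hy : 0 < y) (hσ : 0 < σ) :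
    IntegrableOn (fun t => Real.exp (-σ * t) * passageDensity y t) (Ioi 0) ∧
      ∫ t in Ioi 0, Real.exp (-σ * t) * passageDensity y t = Real.exp (-(y * √σ)) := by
  set Φ : ℝ → ℝ := fun t =>
    (Real.exp (-(y * √σ)) * erfc (y / (2 * √t) + -√σ * √t) +
      Real.exp (y * √σ) * erfc (y / (2 * √t) + √σ * √t)) / 2 with hΦ
  have h0 : Tendsto Φ (𝓝[>] 0) (𝓝 0) := by
    have := ((tendsto_erfc_atTop.comp (tendsto_div_sqrt_add_atTop hy (-√σ))).const_mul
      (Real.exp (-(y * √σ)))).add ((tendsto_erfc_atTop.comp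
      (tendsto_div_sqrt_add_atTop hy √σ)).const_mul (Real.exp (y * √σ))) |>.div_const 2
    simpa [hΦ] using this
  have hσ' : 0 < √σ := Real.sqrt_pos.mpr hσ
  have hinf : Tendsto Φ atTop (𝓝 (Real.exp (-(y * √σ)))) := by
    have h₁ : Tendsto (fun t => y / (2 * √t) + √σ * √t) atTop atTop :=
      (tendsto_div_sqrt_atTop y).add_atTop (Real.tendsto_sqrt_atTop.const_mul_atTop hσ')
    have h₂ : Tendsto (fun t => y / (2 * √t) + -√σ * √t) atTop atBot :=
      (tendsto_div_sqrt_atTop y).add_atBot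
        (Real.tendsto_sqrt_atTop.const_mul_atTop_of_neg (neg_neg_of_pos hσ'))
    have := ((tendsto_erfc_atBot.comp h₂).const_mul (Real.exp (-(y * √σ)))).add
      ((tendsto_erfc_atTop.comp h₁).const_mul (Real.exp (y * √σ))) |>.div_const 2
    simpa [hΦ] using this
  have hderiv : ∀ t : ℝ, 0 < t →
      HasDerivAt Φ (Real.exp (-σ * t) * passageDensity y t) t := by
    intro t ht
    have hs : 0 < √t := Real.sqrt_pos.mpr ht
    have hsq : √t ^ 2 = t := Real.sq_sqrt ht.le
    have hσq : √σ ^ 2 = σ := Real.sq_sqrt hσ.le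
    have h₁ : HasDerivAt (fun t => y / (2 * √t)) (-(y / (4 * (t * √t)))) t := by
      have := ((Real.hasDerivAt_sqrt ht.ne').const_mul 2).inv (by positivity) |>.const_mul y
      refine this.congr_deriv ?_
      field_simp
      rw [hsq]; ring
    have h₂ : ∀ c : ℝ, HasDerivAt (fun t => y / (2 * √t) + c * √t)
        (-(y / (4 * (t * √t))) + c * (1 / (2 * √t))) t := fun c =>
      h₁.add ((Real.hasDerivAt_sqrt ht.ne').const_mul c)
    have h₃ : ∀ c : ℝ, c ^ 2 = σ → Real.exp (y * c) * Real.exp (-(y / (2 * √t) + c * √t) ^ 2) =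
        Real.exp (-σ * t) * Real.exp (-(y ^ 2 / (4 * t))) := fun c hc => by
      rw [← Real.exp_add, ← Real.exp_add]
      congr 1
      have : (y / (2 * √t) + c * √t) ^ 2 = y ^ 2 / (4 * t) + y * c + σ * t := by
        rw [add_sq, mul_pow, hc, hsq, sq_div_two_mul_sqrt y ht]
        field_simp
      rw [this]; ring
    have h₄ := ((((hasDerivAt_erfc _).comp t (h₂ (-√σ))).const_mul (Real.exp (-(y * √σ)))).add
      (((hasDerivAt_erfc _).comp t (h₂ √σ)).const_mul (Real.exp (y * √σ)))).div_const 2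
    refine h₄.congr_deriv ?_
    have e₁ := h₃ (-√σ) (by rw [neg_sq, hσq])
    have e₂ := h₃ √σ hσq
    rw [mul_neg] at e₁
    have hπ : 0 < √Real.pi := by positivity
    calc _ = (-(2 / √Real.pi) * (-(y / (4 * (t * √t))) + -√σ * (1 / (2 * √t))) *
            (Real.exp (-(y * √σ)) * Real.exp (-(y / (2 * √t) + -√σ * √t) ^ 2)) +
          -(2 / √Real.pi) * (-(y / (4 * (t * √t))) + √σ * (1 / (2 * √t))) *
            (Real.exp (y * √σ) * Real.exp (-(y / (2 * √t) + √σ * √t) ^ 2))) / 2 := by ring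
      _ = _ := by
        rw [e₁, e₂, passageDensity]
        field_simp
        ring
  have hcont : ContinuousWithinAt (Function.update Φ 0 0) (Ici 0) 0 := by
    rw [continuousWithinAt_update_same, Ici_sdiff_left]
    exact h0
  have hderiv' : ∀ t ∈ Ioi (0 : ℝ), HasDerivAt (Function.update Φ 0 0)
      (Real.exp (-σ * t) * passageDensity y t) t := fun t ht =>
    (hderiv t ht).congr_of_eventuallyEq (by
      filter_upwards [isOpen_ne.mem_nhds (ne_of_gt ht)] with u hu
      rw [Function.update_of_ne hu])
  have hnonneg : ∀ t ∈ Ioi (0 : ℝ), 0 ≤ Real.exp (-σ * t) * passageDensity y t := fun t ht =>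
    mul_nonneg (Real.exp_pos _).le (passageDensity_nonneg hy.le (le_of_lt ht))
  have hinf' : Tendsto (Function.update Φ 0 0) atTop (𝓝 (Real.exp (-(y * √σ)))) :=
    hinf.congr' (by
      filter_upwards [eventually_gt_atTop 0] with u hu
      rw [Function.update_of_ne hu.ne'])
  refine ⟨integrableOn_Ioi_deriv_of_nonneg hcont hderiv' hnonneg hinf', ?_⟩
  rw [integral_Ioi_of_hasDerivAt_of_nonneg hcont hderiv' hnonneg hinf']
  simp

theorem hasLaplace_passageDensity {y : ℝ} (hy : 0 < y) : HasLaplace 0 (passageDensity y) :=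
  fun _ hσ => (integral_exp_mul_passageDensity hy hσ).1

theorem laplace_passageDensity {y : ℝ} (hy : 0 < y) {s : ℂ} (hs : 0 < s.re) :
    laplace (passageDensity y) s = Complex.exp (-(y * csqrt s)) := by
  refine laplace_eq_of_forall_ofReal (F := fun s => Complex.exp (-(y * csqrt s)))
    (hasLaplace_passageDensity hy) ?_ (fun σ hσ => ?_) hs
  · intro w hw
    exact ((differentiableAt_csqrt hw).const_mul (y : ℂ)).neg.cexp.differentiableWithinAt
  · rw [laplace_ofReal, (integral_exp_mul_passageDensity hy hσ).2, csqrt_ofReal hσ.le]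
    push_cast; rfl

theorem hasLaplace_one : HasLaplace 0 fun _ => 1 := fun σ hσ => by
  simpa using integrableOn_exp_mul_Ioi (neg_neg_of_pos hσ) 0

/-- The passage probability is the integral of the passage density. -/
theorem conv_passageDensity_one {y : ℝ} (hy : 0 < y) {t : ℝ} (ht : 0 < t) :
    conv (passageDensity y) (fun _ => 1) t = erfcHeat y t := by
  have hint : IntervalIntegrable (passageDensity y) volume 0 t :=
    (intervalIntegrable_iff_integrableOn_Ioc_of_le ht.le).mpr
      ((hasLaplace_passageDensity hy).integrableOn_Ioc t)
  have h0 : Tendsto (fun t => erfcHeat y t) (𝓝[>] 0) (𝓝 0) := by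
    have := tendsto_erfc_atTop.comp (tendsto_div_sqrt_add_atTop hy 0)
    refine this.congr fun t => ?_
    simp [erfcHeat]
  have ht' : Tendsto (fun t => erfcHeat y t) (𝓝[<] t) (𝓝 (erfcHeat y t)) :=
    (hasDerivAt_erfcHeat_time y ht).continuousAt.tendsto.mono_left nhdsWithin_le_nhds
  have := intervalIntegral.integral_eq_sub_of_hasDerivAt_of_tendsto ht
    (fun u hu => hasDerivAt_erfcHeat_time y hu.1) hint h0 ht'
  rw [intervalIntegral.integral_of_le ht.le, sub_zero] at this
  simpa [conv] using this

theorem hasLaplace_erfcHeat {y : ℝ} (hy : 0 ≤ y) : HasLaplace 0 (erfcHeat y) := by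
  rcases hy.eq_or_lt with rfl | hy
  · exact hasLaplace_one.congr fun t _ => (erfcHeat_zero t).symm
  · exact ((hasLaplace_passageDensity hy).conv hasLaplace_one).congr fun t ht =>
      conv_passageDensity_one hy ht

theorem laplace_erfcHeat {y : ℝ} (hy : 0 ≤ y) {s : ℂ} (hs : 0 < s.re) :
    laplace (erfcHeat y) s = Complex.exp (-(y * csqrt s)) * laplace (fun _ => 1) s := by
  rcases hy.eq_or_lt with rfl | hy
  · rw [laplace_congr fun t _ => erfcHeat_zero t]
    simp
  · rw [← laplace_congr fun t ht => conv_passageDensity_one hy ht,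
      laplace_conv (hasLaplace_passageDensity hy) hasLaplace_one hs, laplace_passageDensity hy hs]

/-- Reaching the level `y + x` means reaching `y` and then climbing another `x`. -/
theorem conv_passageDensity_erfcHeat {x y : ℝ} (hx : 0 < x) (hy : 0 ≤ y) :
    ∀ᵐ t ∂volume.restrict (Ioi 0), conv (passageDensity x) (erfcHeat y) t =
      erfcHeat (x + y) t := by
  refine ae_eq_of_laplace_eq ((hasLaplace_passageDensity hx).conv (hasLaplace_erfcHeat hy))
    (hasLaplace_erfcHeat (by positivity)) fun s hs => ?_
  rw [laplace_conv (hasLaplace_passageDensity hx) (hasLaplace_erfcHeat hy) hs,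
    laplace_passageDensity hx hs, laplace_erfcHeat hy hs, laplace_erfcHeat (by positivity) hs,
    ← mul_assoc, ← Complex.exp_add]
  push_cast; ring_nf

/-! ### The kernel of the Dirichlet problem on an interval -/

/-- The density of the time at which a Brownian motion with generator `∂ₓₓ` in an interval of
length `a`, started at distance `b` from an end point, leaves through that end point. It is given
by the method of images: the level `b` and its reflections. -/
noncomputable def imageKernel (a b t : ℝ) : ℝ :=
  ∑' n : ℕ, (passageDensity (2 * n * a + b) t - passageDensity (2 * (n + 1) * a - b) t)

section

variable {a b : ℝ}

theorem hasSum_imageKernel_oddKernel (ha : 0 < a) {t : ℝ} (ht : 0 < t) :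
    HasSum (fun n : ℕ => passageDensity (2 * n * a + b) t - passageDensity (2 * (n + 1) * a - b) t)
      (a / (√Real.pi * (t * √t)) *
        HurwitzZeta.oddKernel ((b / (2 * a) : ℝ) : UnitAddCircle) (a ^ 2 / (Real.pi * t))) := by
  have hX : 0 < a ^ 2 / (Real.pi * t) := by positivity
  have h := ((HurwitzZeta.hasSum_int_oddKernel (b / (2 * a)) hX).nat_add_neg_add_one).mul_left
    (a / (√Real.pi * (t * √t)))
  have hterm : ∀ x : ℝ, a / (√Real.pi * (t * √t)) * ((x + b / (2 * a)) *
      Real.exp (-Real.pi * (x + b / (2 * a)) ^ 2 * (a ^ 2 / (Real.pi * t)))) =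
      passageDensity (2 * x * a + b) t := fun x => by
    have hs : 0 < √t := Real.sqrt_pos.mpr ht
    have hπ : 0 < √Real.pi := Real.sqrt_pos.mpr Real.pi_pos
    have he : -Real.pi * (x + b / (2 * a)) ^ 2 * (a ^ 2 / (Real.pi * t)) =
        -((2 * x * a + b) ^ 2 / (4 * t)) := by
      field_simp
      ring
    rw [he, passageDensity, ← mul_assoc]
    congr 1
    field_simp
  have hodd : ∀ ξ : ℝ, passageDensity (-ξ) t = -passageDensity ξ t := fun ξ => by
    simp only [passageDensity, neg_sq]; ring
  refine h.congr_fun fun n => ?_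
  rw [mul_add (a / _), hterm, hterm, sub_eq_add_neg, ← hodd]
  push_cast
  ring_nf

/-- The exit density is nonnegative, because the heat kernel on the circle is decreasing. -/
theorem imageKernel_nonneg (hb : 0 < b) (hab : b ≤ a) {t : ℝ} (ht : 0 < t) :
    0 ≤ imageKernel a b t := by
  have ha : 0 < a := hb.trans_le hab
  rw [imageKernel, (hasSum_imageKernel_oddKernel ha ht).tsum_eq]
  refine mul_nonneg (by positivity) (oddKernel_nonneg ⟨by positivity, ?_⟩ (by positivity))
  rw [div_le_div_iff₀ (by positivity) two_pos]
  linarith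

theorem sum_image_exponentials (hb : 0 < b) (hab : b < a) {z : ℂ} (hz : 0 < z.re) :
    HasSum (fun n : ℕ => Complex.exp (-((2 * n * a + b : ℝ) * z)) -
        Complex.exp (-((2 * (n + 1) * a - b : ℝ) * z)))
      (Complex.sinh ((a - b : ℝ) * z) / Complex.sinh (a * z)) := by
  have ha : 0 < a := hb.trans hab
  have hq : ‖Complex.exp (-(2 * a * z))‖ < 1 := by
    rw [Complex.norm_exp, Real.exp_lt_one_iff]
    have : (-(2 * a * z)).re = -(2 * a * z.re) := by simp
    rw [this, neg_lt_zero]; positivity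
  have hne : 1 - Complex.exp (-(2 * a * z)) ≠ 0 := by
    rw [sub_ne_zero]
    intro h
    rw [← h, norm_one] at hq
    exact lt_irrefl _ hq
  have hsinh : Complex.sinh (a * z) ≠ 0 := sinh_ne_zero_of_re_pos (by
    rw [Complex.re_ofReal_mul]; positivity)
  have h := (hasSum_geometric_of_norm_lt_one hq).mul_left
    (Complex.exp (-(b * z)) - Complex.exp (-((2 * a - b : ℝ) * z)))
  have hval : Complex.sinh ((a - b : ℝ) * z) / Complex.sinh (a * z) =
      (Complex.exp (-(b * z)) - Complex.exp (-((2 * a - b : ℝ) * z))) *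
        (1 - Complex.exp (-(2 * a * z)))⁻¹ := by
    rw [← div_eq_mul_inv, div_eq_div_iff hsinh hne, Complex.sinh, Complex.sinh]
    ring_nf
    simp only [← Complex.exp_add]
    push_cast
    ring_nf
  rw [hval]
  refine h.congr_fun fun n => ?_
  rw [← Complex.exp_nat_mul, sub_mul, ← Complex.exp_add, ← Complex.exp_add]
  push_cast
  ring_nf

theorem summable_image_exponentials (ha : 0 < a) (c : ℝ) {x : ℝ} (hx : 0 < x) :
    Summable fun n : ℕ => Real.exp (-((2 * n * a + c) * x)) := by
  have hq : Real.exp (-(2 * a * x)) < 1 := by rw [Real.exp_lt_one_iff, neg_lt_zero]; positivity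
  refine ((summable_geometric_of_lt_one (Real.exp_pos _).le hq).mul_left
    (Real.exp (-(c * x)))).congr fun n => ?_
  rw [← Real.exp_nat_mul, ← Real.exp_add]
  ring_nf

/-- The transforms of the images form a geometric series. -/
theorem laplace_imageKernel (hb : 0 < b) (hab : b < a) {s : ℂ} (hs : 0 < s.re) :
    laplace (imageKernel a b) s =
      Complex.sinh ((a - b : ℝ) * csqrt s) / Complex.sinh (a * csqrt s) := by
  have ha : 0 < a := hb.trans hab
  have hp₁ : ∀ n : ℕ, 0 < 2 * n * a + b := fun n => by positivity
  have hp₂ : ∀ n : ℕ, 0 < 2 * (n + 1) * a - b := fun n => by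
    have : 0 ≤ (n : ℝ) * a := by positivity
    nlinarith
  have hint₁ := fun n => (hasLaplace_passageDensity (hp₁ n)).integrableOn_cexp hs
  have hint₂ := fun n => (hasLaplace_passageDensity (hp₂ n)).integrableOn_cexp hs
  have hnorm : ∀ {y : ℝ}, 0 < y →
      ∫ t in Ioi (0 : ℝ), ‖Complex.exp (-s * t) * (passageDensity y t : ℂ)‖ =
        Real.exp (-(y * √s.re)) := fun {y} hy => by
    rw [← (integral_exp_mul_passageDensity hy hs).2]
    refine setIntegral_congr_fun measurableSet_Ioi fun t ht => ?_
    rw [norm_mul, norm_cexp_neg_mul, Complex.norm_real,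
      Real.norm_of_nonneg (passageDensity_nonneg hy.le (le_of_lt ht))]
  have hsum : Summable fun n : ℕ => ∫ t in Ioi (0 : ℝ),
      ‖Complex.exp (-s * t) * (passageDensity (2 * n * a + b) t : ℂ) -
        Complex.exp (-s * t) * (passageDensity (2 * (n + 1) * a - b) t : ℂ)‖ := by
    have hσ : 0 < √s.re := Real.sqrt_pos.mpr hs
    refine Summable.of_nonneg_of_le (fun n => integral_nonneg fun t => norm_nonneg _)
      (fun n => ?_) ((summable_image_exponentials ha b hσ).add
        (summable_image_exponentials ha (2 * a - b) hσ))
    have h₂ := hnorm (hp₂ n)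
    rw [show 2 * ((n : ℝ) + 1) * a - b = 2 * n * a + (2 * a - b) by ring] at h₂ ⊢
    rw [← hnorm (hp₁ n), ← h₂]
    have hint₂' := hint₂ n
    rw [show 2 * ((n : ℝ) + 1) * a - b = 2 * n * a + (2 * a - b) by ring] at hint₂'
    rw [← integral_add (hint₁ n).norm hint₂'.norm]
    exact integral_mono ((hint₁ n).sub hint₂').norm ((hint₁ n).norm.add hint₂'.norm)
      fun t => norm_sub_le _ _
  have h := hasSum_integral_of_summable_integral_norm
    (fun n => (hint₁ n).sub (hint₂ n)) hsum
  have h' : HasSum (fun n : ℕ => ∫ t in Ioi (0 : ℝ),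
      (Complex.exp (-s * t) * (passageDensity (2 * n * a + b) t : ℂ) -
        Complex.exp (-s * t) * (passageDensity (2 * (n + 1) * a - b) t : ℂ)))
      (laplace (imageKernel a b) s) := by
    have hval : laplace (imageKernel a b) s = ∫ t in Ioi (0 : ℝ), ∑' n : ℕ,
        (Complex.exp (-s * t) * (passageDensity (2 * n * a + b) t : ℂ) -
          Complex.exp (-s * t) * (passageDensity (2 * (n + 1) * a - b) t : ℂ)) := by
      refine setIntegral_congr_fun measurableSet_Ioi fun t _ => ?_
      simp only [← mul_sub]
      rw [tsum_mul_left, imageKernel, Complex.ofReal_tsum]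
      simp only [Complex.ofReal_sub]
    rw [hval]
    exact h
  refine (h'.unique ((sum_image_exponentials hb hab (csqrt_re_pos hs)).congr_fun fun n => ?_))
  rw [integral_sub (hint₁ n) (hint₂ n)]
  exact congrArg₂ _ (laplace_passageDensity (hp₁ n) hs) (laplace_passageDensity (hp₂ n) hs)

theorem laplace_imageKernel_ofReal (hb : 0 < b) (hab : b < a) {σ : ℝ} (hσ : 0 < σ) :
    ∫ t in Ioi 0, Real.exp (-σ * t) * imageKernel a b t =
      Real.sinh ((a - b) * √σ) / Real.sinh (a * √σ) := by
  have h := laplace_imageKernel hb hab (s := σ) (by simpa using hσ)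
  rw [laplace_ofReal, csqrt_ofReal hσ.le] at h
  exact_mod_cast h

theorem hasLaplace_imageKernel (hb : 0 < b) (hab : b < a) : HasLaplace 0 (imageKernel a b) := by
  intro σ hσ
  refine .of_integral_ne_zero ?_
  have hx : 0 < √σ := Real.sqrt_pos.mpr hσ
  rw [laplace_imageKernel_ofReal hb hab hσ]
  have h₁ : 0 < Real.sinh ((a - b) * √σ) := Real.sinh_pos_iff.mpr (mul_pos (sub_pos.mpr hab) hx)
  have h₂ : 0 < Real.sinh (a * √σ) := Real.sinh_pos_iff.mpr (mul_pos (hb.trans hab) hx)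
  positivity

theorem sinh_mul_le {θ x : ℝ} (hθ0 : 0 ≤ θ) (hθ1 : θ ≤ 1) (hx : 0 ≤ x) :
    Real.sinh (θ * x) ≤ θ * Real.sinh x := by
  have hconv : ConvexOn ℝ (Ici 0) Real.sinh := by
    refine convexOn_of_deriv2_nonneg (convex_Ici 0) Real.continuous_sinh.continuousOn
      Real.differentiable_sinh.differentiableOn (by simp [Real.differentiable_cosh.differentiableOn])
      fun y hy => ?_
    simp only [interior_Ici, mem_Ioi] at hy
    simpa using hy.le
  have := hconv.2 (mem_Ici.mpr hx) (mem_Ici.mpr le_rfl) hθ0 (sub_nonneg.mpr hθ1) (by ring)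
  simpa using this

/-- The probability of leaving an interval of length `a` through the end point at distance `b` is at
most (in fact equal to) `(a - b) / a`. -/
theorem integral_imageKernel_le (hb : 0 < b) (hab : b < a) (t : ℝ) :
    ∫ u in Ioc 0 t, imageKernel a b u ≤ (a - b) / a := by
  have ha : 0 < a := hb.trans hab
  refine (hasLaplace_imageKernel hb hab).integral_le
    (fun t ht => imageKernel_nonneg hb hab.le ht) (fun σ hσ => ?_) t
  have hx : 0 < √σ := Real.sqrt_pos.mpr hσ
  rw [laplace_imageKernel_ofReal hb hab hσ,
    div_le_iff₀ (Real.sinh_pos_iff.mpr (mul_pos ha hx))]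
  have := sinh_mul_le (θ := (a - b) / a) (x := a * √σ)
    (div_nonneg (sub_pos.mpr hab).le ha.le) (by rw [div_le_one ha]; linarith) (by positivity)
  rwa [show (a - b) / a * (a * √σ) = (a - b) * √σ by field_simp] at this

theorem laplace_imageKernel_two_mul (hb : 0 < b) {s : ℂ} (hs : 0 < s.re) :
    laplace (imageKernel (2 * b) b) s = 1 / (2 * Complex.cosh (b * csqrt s)) := by
  have hz : 0 < ((b : ℂ) * csqrt s).re := by
    rw [Complex.re_ofReal_mul]; exact mul_pos hb (csqrt_re_pos hs)
  rw [laplace_imageKernel hb (by linarith) hs]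
  have h₁ : ((2 * b - b : ℝ) : ℂ) * csqrt s = b * csqrt s := by push_cast; ring
  have h₂ : ((2 * b : ℝ) : ℂ) * csqrt s = 2 * (b * csqrt s) := by push_cast; ring
  rw [h₁, h₂, Complex.sinh_two_mul, div_eq_div_iff
    (by simp [sinh_ne_zero_of_re_pos hz, cosh_ne_zero_of_re_pos hz])
    (by simp [cosh_ne_zero_of_re_pos hz])]
  ring

/-- A Brownian motion reaches the level `b` either before the level `-b`, or from there by
climbing `2b`. In terms of transforms, `e^{-x} = (1 + e^{-2x}) / (2 cosh x)`. -/
theorem imageKernel_two_mul_le (hb : 0 < b) :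
    ∀ᵐ t ∂volume.restrict (Ioi 0), imageKernel (2 * b) b t ≤ passageDensity b t := by
  have hq := hasLaplace_imageKernel hb (by linarith : b < 2 * b)
  have h2b : 0 < 2 * b := by positivity
  have hp := hasLaplace_passageDensity h2b
  have h := ae_eq_of_laplace_eq (hasLaplace_passageDensity hb) (hq.add (hp.conv hq)) fun s hs => by
    have hz : 0 < ((b : ℂ) * csqrt s).re := by
      rw [Complex.re_ofReal_mul]; exact mul_pos hb (csqrt_re_pos hs)
    rw [laplace_add hq (hp.conv hq) hs, laplace_conv hp hq hs, laplace_passageDensity hb hs,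
      laplace_passageDensity h2b hs, laplace_imageKernel_two_mul hb hs, ← one_add_mul,
      mul_one_div, eq_div_iff (by simp [cosh_ne_zero_of_re_pos hz]), Complex.cosh]
    rw [mul_div_cancel₀ _ two_ne_zero, mul_add, ← Complex.exp_add, ← Complex.exp_add]
    push_cast
    ring_nf
    simp
  filter_upwards [h, ae_restrict_mem measurableSet_Ioi] with t ht htpos
  rw [ht, le_add_iff_nonneg_right]
  refine setIntegral_nonneg_of_ae_restrict ?_
  rw [← restrict_Ioo_eq_restrict_Ioc]
  filter_upwards [ae_restrict_mem measurableSet_Ioo] with u hu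
  exact mul_nonneg (passageDensity_nonneg h2b.le hu.1.le)
    (imageKernel_nonneg hb (by linarith) (sub_pos.mpr hu.2))

end

/-! ### The transformed subdomain problems -/

/-- The Wronskian of two solutions of `v'' = s v` is constant. The function `v` solves the equation
only in the open interval, and its one-sided derivatives enter at the end points. -/
theorem SolvesODE.wronskian {s : ℂ} {l r : ℝ} {v φ φ' : ℝ → ℂ} (hlr : l < r)
    (hv : SolvesODE s l r v) (hφ : ∀ x, HasDerivAt φ (φ' x) x)
    (hφ' : ∀ x, HasDerivAt φ' (s * φ x) x) :
    derivWithin v (Icc l r) r * φ r - v r * φ' r =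
      derivWithin v (Icc l r) l * φ l - v l * φ' l := by
  have huniq : UniqueDiffOn ℝ (Icc l r) := uniqueDiffOn_Icc hlr
  have hc : ContinuousOn (fun x => derivWithin v (Icc l r) x * φ x - v x * φ' x) (Icc l r) := by
    have hφc : Continuous φ := continuous_iff_continuousAt.mpr fun x => (hφ x).continuousAt
    have hφc' : Continuous φ' := continuous_iff_continuousAt.mpr fun x => (hφ' x).continuousAt
    exact ((hv.contDiffOn.continuousOn_derivWithin huniq (by norm_num)).mul hφc.continuousOn).sub
      (hv.contDiffOn.continuousOn.mul hφc'.continuousOn)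
  have hd : ∀ x ∈ Ioo l r,
      HasDerivAt (fun x => derivWithin v (Icc l r) x * φ x - v x * φ' x) 0 x := by
    intro x hx
    have hnhds : Icc l r ∈ 𝓝 x := Icc_mem_nhds hx.1 hx.2
    have hcd : ContDiffAt ℝ 2 v x := hv.contDiffOn.contDiffAt hnhds
    have h₁ : HasDerivAt v (deriv v x) x := (hcd.differentiableAt (by norm_num)).hasDerivAt
    have h₂ : HasDerivAt (deriv v) (s * v x) x := by
      have hdd : DifferentiableAt ℝ (deriv v) x :=
        (hcd.derivWithin (m := 1) (by norm_num)).differentiableAt (by norm_num)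
      have := hv.eq_zero x hx
      rw [iteratedDeriv_succ, iteratedDeriv_one, sub_eq_zero] at this
      rw [this]
      exact hdd.hasDerivAt
    have heq : (fun y => derivWithin v (Icc l r) y * φ y - v y * φ' y) =ᶠ[𝓝 x]
        fun y => deriv v y * φ y - v y * φ' y := by
      filter_upwards [Ioo_mem_nhds hx.1 hx.2] with y hy
      rw [derivWithin_of_mem_nhds (Icc_mem_nhds hy.1 hy.2)]
    refine (((h₂.mul (hφ x)).sub (h₁.mul (hφ' x))).congr_deriv ?_).congr_of_eventuallyEq heq
    ring
  have := intervalIntegral.integral_eq_sub_of_hasDerivAt_of_le hlr.le hc hd (by simp)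
  rw [intervalIntegral.integral_zero] at this
  exact sub_eq_zero.mp this.symm

theorem hasDerivAt_sinh_affine (z d : ℂ) (x : ℝ) :
    HasDerivAt (fun x : ℝ => Complex.sinh (z * (x + d))) (z * Complex.cosh (z * (x + d))) x := by
  have h := ((Complex.hasDerivAt_sinh (z * ((x : ℂ) + d))).comp (x : ℂ)
    (((hasDerivAt_id' (x : ℂ)).add_const d).const_mul z)).comp_ofReal
  refine h.congr_deriv ?_
  ring

theorem hasDerivAt_cosh_affine (z d : ℂ) (x : ℝ) :
    HasDerivAt (fun x : ℝ => z * Complex.cosh (z * (x + d)))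
      (z ^ 2 * Complex.sinh (z * (x + d))) x := by
  have h := (((Complex.hasDerivAt_cosh (z * ((x : ℂ) + d))).comp (x : ℂ)
    (((hasDerivAt_id' (x : ℂ)).add_const d).const_mul z)).const_mul z).comp_ofReal
  refine h.congr_deriv ?_
  ring

theorem solvesODE_sinh (C z d : ℂ) (l r : ℝ) :
    SolvesODE (z ^ 2) l r fun x => C * Complex.sinh (z * (x + d)) := by
  have h₁ : ∀ x : ℝ, HasDerivAt (fun x : ℝ => C * Complex.sinh (z * (x + d)))
      (C * (z * Complex.cosh (z * (x + d)))) x := fun x =>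
    (hasDerivAt_sinh_affine z d x).const_mul C
  have h₂ : ∀ x : ℝ, HasDerivAt (fun x : ℝ => C * (z * Complex.cosh (z * (x + d))))
      (C * (z ^ 2 * Complex.sinh (z * (x + d)))) x := fun x =>
    (hasDerivAt_cosh_affine z d x).const_mul C
  refine ⟨ContDiff.contDiffOn ?_, fun x _ => ?_⟩
  · rw [show (2 : WithTop ℕ∞) = 1 + 1 by norm_num, contDiff_succ_iff_deriv]
    refine ⟨fun x => (h₁ x).differentiableAt, by simp, ?_⟩
    rw [funext fun x => (h₁ x).deriv, contDiff_one_iff_deriv]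
    refine ⟨fun x => (h₂ x).differentiableAt, ?_⟩
    rw [funext fun x => (h₂ x).deriv]
    fun_prop
  · rw [iteratedDeriv_succ, iteratedDeriv_one, funext fun x => (h₁ x).deriv, (h₂ x).deriv]
    ring

/-- The Dirichlet-to-Neumann map of the Dirichlet subdomain. -/
theorem SolvesODE.deriv_mul_sinh {a : ℝ} {z : ℂ} {v : ℝ → ℂ} (ha : 0 < a)
    (hv : SolvesODE (z ^ 2) (-a) 0 v) (h0 : v (-a) = 0) :
    derivWithin v (Icc (-a) 0) 0 * Complex.sinh (a * z) = v 0 * (z * Complex.cosh (a * z)) := by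
  have h := hv.wronskian (neg_lt_zero.mpr ha) (hasDerivAt_sinh_affine z a)
    (hasDerivAt_cosh_affine z a)
  rw [h0] at h
  simp only [Complex.ofReal_zero, zero_add, Complex.ofReal_neg, neg_add_cancel, mul_zero,
    Complex.sinh_zero, zero_mul, sub_zero] at h
  rw [mul_comm (a : ℂ) z]
  exact sub_eq_zero.mp h

/-- The Neumann-to-Dirichlet map of the Neumann subdomain. -/
theorem SolvesODE.mul_cosh {b : ℝ} {z : ℂ} {v : ℝ → ℂ} (hb : 0 < b)
    (hv : SolvesODE (z ^ 2) 0 b v) (h0 : v b = 0) :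
    v 0 * (z * Complex.cosh (b * z)) = -(derivWithin v (Icc 0 b) 0 * Complex.sinh (b * z)) := by
  have h := hv.wronskian hb (hasDerivAt_sinh_affine z (-b)) (hasDerivAt_cosh_affine z (-b))
  rw [h0] at h
  simp only [Complex.ofReal_zero, zero_add, add_neg_cancel, mul_zero, Complex.sinh_zero, zero_mul,
    sub_zero, mul_neg, Complex.sinh_neg, Complex.cosh_neg] at h
  rw [mul_comm (b : ℂ) z]
  linear_combination h

/-! ### The interface update as a convolution -/

/-- The multiplier of one step: the composition of the Dirichlet-to-Neumann and
Neumann-to-Dirichlet maps with the relaxation, as a product of two exit transforms. -/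
theorem symbol_eq {a b : ℝ} {z : ℂ} (ha : 0 < a) (hb : 0 < b) (hz : 0 < z.re) :
    1 / 2 * -(Complex.cosh (a * z) / Complex.sinh (a * z) *
        (Complex.sinh (b * z) / Complex.cosh (b * z))) + (1 - 1 / 2) =
      1 / (2 * Complex.cosh (b * z)) *
        (Complex.sinh ((a - b : ℝ) * z) / Complex.sinh (a * z)) := by
  have h₁ : Complex.sinh (a * z) ≠ 0 := sinh_ne_zero_of_re_pos (by
    rw [Complex.re_ofReal_mul]; exact mul_pos ha hz)
  have h₂ : Complex.cosh (b * z) ≠ 0 := cosh_ne_zero_of_re_pos (by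
    rw [Complex.re_ofReal_mul]; exact mul_pos hb hz)
  rw [Complex.ofReal_sub, sub_mul, Complex.sinh_sub]
  generalize Complex.sinh (a * z) = S₁ at *
  generalize Complex.cosh (b * z) = C₂ at *
  field_simp
  ring

/-- The update of the interface function in the time domain: two convolutions with exit
densities. -/
noncomputable def interfaceStep (a b : ℝ) (f : ℝ → ℝ) : ℝ → ℝ :=
  conv (imageKernel (2 * b) b) (conv (imageKernel a b) f)

section

variable {a b c : ℝ}

theorem HasLaplace.interfaceStep {f : ℝ → ℝ} (hb : 0 < b) (hab : b < a) (hc : 0 ≤ c)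
    (hf : HasLaplace c f) : HasLaplace c (interfaceStep a b f) :=
  ((hasLaplace_imageKernel hb (by linarith)).mono hc).conv
    (((hasLaplace_imageKernel hb hab).mono hc).conv hf)

theorem laplace_interfaceStep {f : ℝ → ℝ} (hb : 0 < b) (hab : b < a) (hc : 0 ≤ c)
    (hf : HasLaplace c f) {s : ℂ} (hs : c < s.re) :
    laplace (interfaceStep a b f) s = 1 / (2 * Complex.cosh (b * csqrt s)) *
      (Complex.sinh ((a - b : ℝ) * csqrt s) / Complex.sinh (a * csqrt s)) * laplace f s := by
  have hr := (hasLaplace_imageKernel hb hab).mono hc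
  have hq := (hasLaplace_imageKernel hb (by linarith : b < 2 * b)).mono hc
  have hs0 : 0 < s.re := hc.trans_lt hs
  rw [interfaceStep, laplace_conv hq (hr.conv hf) hs, laplace_conv hr hf hs,
    laplace_imageKernel_two_mul hb hs0, laplace_imageKernel hb hab hs0, mul_assoc]

theorem IsLaplaceIteration.ae_eq_interfaceStep {h : ℕ → ℝ → ℝ} {U₁ U₂ : ℕ → ℝ → ℂ → ℂ}
    (hb : 0 < b) (hab : b < a) (hc : 0 ≤ c)
    (hit : IsLaplaceIteration a b (1 / 2) c h U₁ U₂) (k : ℕ) :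
    ∀ᵐ t ∂volume.restrict (Ioi 0), h (k + 1) t = interfaceStep a b (h k) t := by
  have ha : 0 < a := hb.trans hab
  refine ae_eq_of_laplace_eq (hit.hasLaplace (k + 1))
    ((hit.hasLaplace k).interfaceStep hb hab hc) fun s hs => ?_
  have hz := csqrt_re_pos (hc.trans_lt hs)
  have hz0 : csqrt s ≠ 0 := by rintro h; simp [h] at hz
  have hsinh : Complex.sinh (a * csqrt s) ≠ 0 := sinh_ne_zero_of_re_pos (by
    rw [Complex.re_ofReal_mul]; exact mul_pos ha hz)
  have hcosh : Complex.cosh (b * csqrt s) ≠ 0 := cosh_ne_zero_of_re_pos (by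
    rw [Complex.re_ofReal_mul]; exact mul_pos hb hz)
  have hode₁ := hit.ode₁ k s hs
  have hode₂ := hit.ode₂ k s hs
  rw [← csqrt_sq s] at hode₁ hode₂
  have h₁ := hode₁.deriv_mul_sinh ha (by rw [csqrt_sq]; exact hit.outer₁ k s hs)
  have h₂ := hode₂.mul_cosh hb (by rw [csqrt_sq]; exact hit.outer₂ k s hs)
  simp only [csqrt_sq] at h₁ h₂
  rw [hit.dirichlet k s hs] at h₁
  rw [hit.neumann k s hs] at h₂
  have hU : U₂ (k + 1) 0 s = -(Complex.cosh (a * csqrt s) / Complex.sinh (a * csqrt s) *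
      (Complex.sinh (b * csqrt s) / Complex.cosh (b * csqrt s))) * laplace (h k) s := by
    rw [← eq_div_iff hsinh] at h₁
    rw [h₁, ← eq_div_iff (mul_ne_zero hz0 hcosh)] at h₂
    rw [h₂]
    field_simp
  rw [hit.update k s hs, laplace_interfaceStep hb hab hc (hit.hasLaplace k) hs,
    ← symbol_eq ha hb hz, hU]
  push_cast
  ring

/-- The transformed iteration can be carried out for every initial guess that has a Laplace
transform. -/
theorem exists_isLaplaceIteration (hb : 0 < b) (hab : b < a) (hc : 0 ≤ c) {h₀ : ℝ → ℝ}
    (hh : HasLaplace c h₀) : ∃ (h : ℕ → ℝ → ℝ) (U₁ U₂ : ℕ → ℝ → ℂ → ℂ),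
      h 0 = h₀ ∧ IsLaplaceIteration a b (1 / 2) c h U₁ U₂ := by
  have ha : 0 < a := hb.trans hab
  set h : ℕ → ℝ → ℝ := fun k => (interfaceStep a b)^[k] h₀ with hdef
  have hsucc : ∀ k, h (k + 1) = interfaceStep a b (h k) := fun k =>
    Function.iterate_succ_apply' _ _ _
  have hL : ∀ k, HasLaplace c (h k) := fun k => by
    induction k with
    | zero => exact hh
    | succ k ih => rw [hsucc]; exact ih.interfaceStep hb hab hc
  set A : ℕ → ℂ → ℂ := fun k s => laplace (h (k - 1)) s / Complex.sinh (a * csqrt s) with hA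
  set B : ℕ → ℂ → ℂ := fun k s =>
    A k s * Complex.cosh (a * csqrt s) / Complex.cosh (b * csqrt s) with hB
  have hz : ∀ s : ℂ, c < s.re → 0 < (csqrt s).re := fun s hs => csqrt_re_pos (hc.trans_lt hs)
  have hsinh : ∀ s : ℂ, c < s.re → Complex.sinh (a * csqrt s) ≠ 0 := fun s hs =>
    sinh_ne_zero_of_re_pos (by rw [Complex.re_ofReal_mul]; exact mul_pos ha (hz s hs))
  have hcosh : ∀ s : ℂ, c < s.re → Complex.cosh (b * csqrt s) ≠ 0 := fun s hs =>
    cosh_ne_zero_of_re_pos (by rw [Complex.re_ofReal_mul]; exact mul_pos hb (hz s hs))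
  refine ⟨h, fun k x s => A k s * Complex.sinh (csqrt s * (x + a)),
    fun k x s => B k s * Complex.sinh (csqrt s * (x + -b)), rfl, hL, ?_, ?_, ?_, ?_, ?_, ?_, ?_⟩
  · intro k s _
    have := solvesODE_sinh (A (k + 1) s) (csqrt s) a (-a) 0
    rwa [csqrt_sq] at this
  · intro k s _
    simp
  · intro k s hs
    simp only [Complex.ofReal_zero, zero_add, hA, Nat.add_sub_cancel]
    rw [mul_comm (csqrt s), div_mul_cancel₀ _ (hsinh s hs)]
  · intro k s _
    have := solvesODE_sinh (B (k + 1) s) (csqrt s) (-b) 0 b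
    rwa [csqrt_sq] at this
  · intro k s _
    simp
  · intro k s hs
    rw [((hasDerivAt_sinh_affine (csqrt s) (-b) 0).const_mul
        (B (k + 1) s)).hasDerivWithinAt.derivWithin (uniqueDiffOn_Icc hb _ ⟨le_rfl, hb.le⟩),
      ((hasDerivAt_sinh_affine (csqrt s) a 0).const_mul (A (k + 1) s)).hasDerivWithinAt.derivWithin
        (uniqueDiffOn_Icc (neg_lt_zero.mpr ha) _ ⟨(neg_lt_zero.mpr ha).le, le_rfl⟩)]
    simp only [Complex.ofReal_zero, zero_add, mul_neg, Complex.cosh_neg, hB]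
    rw [mul_comm (csqrt s) (b : ℂ), mul_comm (csqrt s) (a : ℂ)]
    have := hcosh s hs
    generalize Complex.cosh (b * csqrt s) = C₂ at *
    field_simp
  · intro k s hs
    rw [hsucc, laplace_interfaceStep hb hab hc (hL k) hs, ← symbol_eq ha hb (hz s hs)]
    simp only [Complex.ofReal_zero, zero_add, mul_neg, Complex.sinh_neg, hB, hA,
      Nat.add_sub_cancel]
    rw [mul_comm (csqrt s) (b : ℂ)]
    push_cast
    have := hcosh s hs
    have := hsinh s hs
    field_simp

/-! ### Bounds for the transformed iteration -/

theorem abs_interfaceStep_le (hb : 0 < b) (hab : b < a) {f : ℝ → ℝ} {M t : ℝ} (hM : 0 ≤ M)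
    (hf : ∀ᵐ u ∂volume.restrict (Ioi 0), |f u| ≤ M) :
    |interfaceStep a b f t| ≤ (a - b) / (2 * a) * M := by
  have ha : 0 < a := hb.trans hab
  have h2b : b < 2 * b := by linarith
  have hsub : ∀ {g : ℝ → ℝ} {N : ℝ} (t : ℝ), (∀ᵐ u ∂volume.restrict (Ioi 0), |g u| ≤ N) →
      ∀ᵐ u ∂volume.restrict (Ioo 0 t), |g u| ≤ N := fun t h =>
    ae_restrict_of_ae_restrict_of_subset (fun u hu => hu.1) h
  have h₁ : ∀ t, |conv (imageKernel a b) f t| ≤ (a - b) / a * M := fun t =>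
    abs_conv_le_mul (m := fun _ => M) (fun u hu => imageKernel_nonneg hb hab.le hu)
      ((hasLaplace_imageKernel hb hab).integrableOn_Ioc t) (integral_imageKernel_le hb hab t) hM
      (fun _ _ => le_rfl) (hsub t hf)
  have h₂ := abs_conv_le_mul (t := t) (m := fun _ => (a - b) / a * M)
    (fun u hu => imageKernel_nonneg hb h2b.le hu)
    ((hasLaplace_imageKernel hb h2b).integrableOn_Ioc t) (integral_imageKernel_le hb h2b t)
    (mul_nonneg (div_nonneg (sub_pos.mpr hab).le ha.le) hM) (fun _ _ => le_rfl)
    (ae_of_all _ h₁)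
  refine h₂.trans_eq ?_
  field_simp
  ring

theorem measurable_erfcHeat (y : ℝ) : Measurable (erfcHeat y) :=
  continuous_erfc.measurable.comp (by fun_prop)

theorem integrableOn_mul_erfcHeat {f : ℝ → ℝ} {y t : ℝ} (hy : 0 ≤ y)
    (hf : IntegrableOn f (Ioc 0 t)) (C : ℝ) :
    IntegrableOn (fun u => f u * (C * erfcHeat y (t - u))) (Ioc 0 t) := by
  refine hf.mul_bdd (c := |C|) ?_ (ae_of_all _ fun u => ?_)
  · exact (((measurable_erfcHeat y).comp (by fun_prop)).const_mul C).aestronglyMeasurable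
  · rw [norm_mul, Real.norm_eq_abs, Real.norm_of_nonneg (erfcHeat_pos _ _).le]
    refine mul_le_of_le_one_right (abs_nonneg C) ?_
    rw [← erfc_zero]
    exact antitone_erfc (by positivity)

/-- The superlinear bound gains one level `b` per step, because the kernel of the Neumann
subdomain is dominated by the passage density of the level `b`. -/
theorem ae_abs_interfaceStep_le (hb : 0 < b) (hab : b < a) {f : ℝ → ℝ} {C T y : ℝ} (hC : 0 ≤ C)
    (hy : 0 ≤ y) (hf : ∀ᵐ u ∂volume.restrict (Ioo 0 T), |f u| ≤ C * erfcHeat y u) :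
    ∀ᵐ t ∂volume.restrict (Ioo 0 T),
      |interfaceStep a b f t| ≤ (a - b) / a * C * erfcHeat (b + y) t := by
  have ha : 0 < a := hb.trans hab
  have h2b : b < 2 * b := by linarith
  have hD : 0 ≤ (a - b) / a * C := mul_nonneg (div_nonneg (sub_pos.mpr hab).le ha.le) hC
  have h₁ : ∀ t ∈ Ioo 0 T, |conv (imageKernel a b) f t| ≤ (a - b) / a * C * erfcHeat y t := by
    intro t ht
    have hC' := mul_nonneg hC (erfcHeat_pos y t).le
    refine (abs_conv_le_mul (m := fun u => C * erfcHeat y u)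
      (fun u hu => imageKernel_nonneg hb hab.le hu)
      ((hasLaplace_imageKernel hb hab).integrableOn_Ioc t) (integral_imageKernel_le hb hab t) hC'
      (fun u hu => mul_le_mul_of_nonneg_left (erfcHeat_mono hy hu.1 hu.2.le) hC)
      (ae_restrict_of_ae_restrict_of_subset (Ioo_subset_Ioo_right ht.2.le) hf)).trans_eq ?_
    ring
  have hconv : ∀ᵐ t ∂volume.restrict (Ioo 0 T), conv (passageDensity b) (erfcHeat y) t =
      erfcHeat (b + y) t :=
    ae_restrict_of_ae_restrict_of_subset (fun u hu => hu.1) (conv_passageDensity_erfcHeat hb hy)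
  filter_upwards [hconv, ae_restrict_mem measurableSet_Ioo] with t ht htT
  have hqint := (hasLaplace_imageKernel hb h2b).integrableOn_Ioc t
  have hpint := (hasLaplace_passageDensity hb).integrableOn_Ioc t
  calc |interfaceStep a b f t|
      ≤ conv (imageKernel (2 * b) b) (fun u => (a - b) / a * C * erfcHeat y u) t := by
        refine abs_conv_le (fun u hu => imageKernel_nonneg hb h2b.le hu) ?_
          (integrableOn_mul_erfcHeat hy hqint _)
        filter_upwards [ae_restrict_mem measurableSet_Ioo] with u hu
        exact h₁ u ⟨hu.1, hu.2.trans htT.2⟩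
    _ ≤ conv (passageDensity b) (fun u => (a - b) / a * C * erfcHeat y u) t := by
        refine integral_mono_ae (integrableOn_mul_erfcHeat hy hqint _)
          (integrableOn_mul_erfcHeat hy hpint _) ?_
        filter_upwards [ae_restrict_of_ae_restrict_of_subset Ioc_subset_Ioi_self
          (imageKernel_two_mul_le hb)] with u hu
        exact mul_le_mul_of_nonneg_right hu (mul_nonneg hD (erfcHeat_pos _ _).le)
    _ = (a - b) / a * C * conv (passageDensity b) (erfcHeat y) t := by
        rw [conv, conv, ← integral_const_mul]
        congr 1
        funext u
        ring
    _ = (a - b) / a * C * erfcHeat (b + y) t := by rw [ht]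

theorem IsLaplaceIteration.supNorm_le_linear {h : ℕ → ℝ → ℝ} {U₁ U₂ : ℕ → ℝ → ℂ → ℂ}
    (hb : 0 < b) (hab : b < a) (hc : 0 ≤ c)
    (hit : IsLaplaceIteration a b (1 / 2) c h U₁ U₂) (k : ℕ) :
    supNorm (Ioi 0) (h k) ≤
      ENNReal.ofReal (((a - b) / (2 * a)) ^ k) * supNorm (Ioi 0) (h 0) := by
  have ha : 0 < a := hb.trans hab
  have hρ : 0 < (a - b) / (2 * a) := div_pos (sub_pos.mpr hab) (by positivity)
  refine supNorm_le_mul (pow_pos hρ k) fun hM => ?_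
  induction k with
  | zero => simpa using ae_abs_le_supNorm hM
  | succ k ih =>
    filter_upwards [hit.ae_eq_interfaceStep hb hab hc k] with t ht
    rw [ht]
    refine (abs_interfaceStep_le hb hab (by positivity) ih).trans_eq ?_
    rw [pow_succ]
    ring

theorem IsLaplaceIteration.supNorm_le_superlinear {h : ℕ → ℝ → ℝ} {U₁ U₂ : ℕ → ℝ → ℂ → ℂ}
    (hb : 0 < b) (hab : b < a) (hc : 0 ≤ c)
    (hit : IsLaplaceIteration a b (1 / 2) c h U₁ U₂) (T : ℝ) (k : ℕ) :
    supNorm (Ioo 0 T) (h k) ≤ ENNReal.ofReal (((a - b) / a) ^ k * erfcHeat (k * b) T) *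
      supNorm (Ioo 0 T) (h 0) := by
  have ha : 0 < a := hb.trans hab
  have hρ : 0 < (a - b) / a := div_pos (sub_pos.mpr hab) ha
  refine supNorm_le_mul (mul_pos (pow_pos hρ k) (erfcHeat_pos _ _)) fun hM => ?_
  set M := (supNorm (Ioo 0 T) (h 0)).toReal
  have hM0 : 0 ≤ M := ENNReal.toReal_nonneg
  have key : ∀ k : ℕ, ∀ᵐ t ∂volume.restrict (Ioo 0 T),
      |h k t| ≤ ((a - b) / a) ^ k * M * erfcHeat (k * b) t := by
    intro k
    induction k with
    | zero => simpa [erfcHeat_zero] using ae_abs_le_supNorm hM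
    | succ k ih =>
      filter_upwards [ae_restrict_of_ae_restrict_of_subset (fun u hu => hu.1)
          (hit.ae_eq_interfaceStep hb hab hc k),
        ae_abs_interfaceStep_le hb hab (by positivity) (by positivity) ih] with t ht hstep
      rw [ht]
      refine hstep.trans_eq ?_
      rw [pow_succ, show ((k + 1 : ℕ) : ℝ) * b = b + k * b by push_cast; ring]
      ring
  filter_upwards [key k, ae_restrict_mem measurableSet_Ioo] with t ht htT
  refine ht.trans ?_
  rw [mul_right_comm]
  have := erfcHeat_mono (ξ := k * b) (by positivity) htT.1 htT.2.le
  gcongr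

end

end DNWR

/-- Convergence of DNWR when the Dirichlet subdomain `(-a, 0)` is larger than the Neumann
subdomain `(0, b)` and `θ = 1/2`. The first two parts concern the Laplace transformed iteration,
with an arbitrary Laplace transformable initial guess: it can be carried out, and satisfies both
estimates. The last two parts are the estimates for classical solutions of the heat equation on
the windows `(0, ∞)` and `(0, T)`. -/
theorem theorem2 (a b : ℝ) (hb : 0 < b) (hab : b < a) :
    (∀ c : ℝ, 0 ≤ c → ∀ h₀ : ℝ → ℝ, DNWR.HasLaplace c h₀ →
      ∃ (h : ℕ → ℝ → ℝ) (U₁ U₂ : ℕ → ℝ → ℂ → ℂ),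
        h 0 = h₀ ∧ DNWR.IsLaplaceIteration a b (1 / 2) c h U₁ U₂) ∧
    (∀ c : ℝ, 0 ≤ c → ∀ (h : ℕ → ℝ → ℝ) (U₁ U₂ : ℕ → ℝ → ℂ → ℂ),
      DNWR.IsLaplaceIteration a b (1 / 2) c h U₁ U₂ →
        (∀ k : ℕ, DNWR.supNorm (Set.Ioi 0) (h k) ≤
          ENNReal.ofReal (((a - b) / (2 * a)) ^ k) * DNWR.supNorm (Set.Ioi 0) (h 0)) ∧
        (∀ T : ℝ, 0 < T → ∀ k : ℕ, DNWR.supNorm (Set.Ioo 0 T) (h k) ≤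
          ENNReal.ofReal (((a - b) / a) ^ k * DNWR.erfc (k * b / (2 * Real.sqrt T))) *
            DNWR.supNorm (Set.Ioo 0 T) (h 0))) ∧
    (∀ (h : ℕ → ℝ → ℝ) (u₁ u₂ : ℕ → ℝ → ℝ → ℝ),
      DNWR.IsClassicalIteration a b (1 / 2) (Set.Ioi 0) h u₁ u₂ →
        ∀ k : ℕ, DNWR.supNorm (Set.Ioi 0) (h k) ≤
          ENNReal.ofReal (((a - b) / (2 * a)) ^ k) * DNWR.supNorm (Set.Ioi 0) (h 0)) ∧
    (∀ T : ℝ, 0 < T → ∀ (h : ℕ → ℝ → ℝ) (u₁ u₂ : ℕ → ℝ → ℝ → ℝ),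
      DNWR.IsClassicalIteration a b (1 / 2) (Set.Ioo 0 T) h u₁ u₂ →
        ∀ k : ℕ, DNWR.supNorm (Set.Ioo 0 T) (h k) ≤
          ENNReal.ofReal (((a - b) / a) ^ k * DNWR.erfc (k * b / (2 * Real.sqrt T))) *
            DNWR.supNorm (Set.Ioo 0 T) (h 0)) := by
  refine ⟨fun c hc h₀ hh => DNWR.exists_isLaplaceIteration hb hab hc hh,
    fun c hc h U₁ U₂ hit => ⟨fun k => hit.supNorm_le_linear hb hab hc k,
      fun T _ k => hit.supNorm_le_superlinear hb hab hc T k⟩,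
    fun h u₁ u₂ hit k => hit.supNorm_le_linear hb hab DNWR.isTimeWindow_Ioi isOpen_Ioi k,
    fun T _ h u₁ u₂ hit k => hit.supNorm_le_superlinear hb hab k⟩
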